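/- Let $d_\gamma\ge 1$, let $\|\cdot\|$ denote an $\ell_r$ norm with $r\in[1,\infty]$ (on $\mathbb R^{d_\gamma}$ and on $\mathbb R^{d_\xi}$), and let $(\gamma,\xi)$ be a random vector with joint distribution $\mathbb P$, where $\gamma\in\Gamma\subseteq\mathbb R^{d_\gamma}$ and $\xi\in\mathbb R^{d_\xi}$. For $\bar\gamma\in\Gamma$ let $\mathbb P_{\bar\gamma}$ denote the conditional distribution of $\xi$ given $\gamma=\bar\gamma$ (a regular version). For probability distributions $\mathbb Q,\mathbb Q'$ on $\mathbb R^{d_\xi}$ let $\mathsf d_1(\mathbb Q,\mathbb Q')$ be the type-1 Wasserstein distance, i.e. the infimum of $\mathbb E\|\xi-\xi'\|$ over all joint distributions of $(\xi,\xi')$ with marginals $\mathbb Q$ and $\mathbb Q'$. Let $(\gamma^1,\xi^1),(\gamma^2,\xi^2),\ldots$ be i.i.d. samples from $\mathbb P$, and let $\mathbb P^\infty$ be the distribution of the whole sequence. Assume: (1) The weights $w_N^i(\bar\gamma)$ ($1\le i\le N$) and the radii $\epsilon_N$ satisfy one of the following. (a) For constants $k_1,k_3>0$, $\delta\in(\frac12,1)$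 and $0<p<\min\left(\frac{1-\delta}{d_\gamma},\frac{2\delta-1}{d_\xi+2}\right)$: $\epsilon_N=k_1/N^p$, and, with $k_N=\min(\lceil k_3N^\delta\rceil,N-1)$, $w_N^i(\bar\gamma)=1/k_N$ if $\gamma^i$ is a $k_N$-nearest neighbor of $\bar\gamma$ and $w_N^i(\bar\gamma)=0$ otherwise. Here $\gamma^i$ is a $k$-nearest neighbor of $\bar\gamma$ if fewer than $k$ of the indices $j\in\{1,\ldots,N\}\setminus\{i\}$ satisfy $\|\gamma^j-\bar\gamma\|<\|\gamma^i-\bar\gamma\|$, or $\|\gamma^j-\bar\gamma\|=\|\gamma^i-\bar\gamma\|$ and $j<i$. (b) For constants $k_1,k_4>0$, $\delta\in\left(0,\frac1{2d_\gamma}\right)$ and $0<p<\min\left(\delta,\frac{1-\delta d_\gamma}{2+d_\xi}\right)$: $\epsilon_N=k_1/N^p$, and, with $h_N=k_4N^{-\delta}$, $$w_N^i(\bar\gamma)=\frac{K(\|\gamma^i-\bar\gamma\|/h_N)}{\sum_{j=1}^NK(\|\gamma^j-\bar\gamma\|/h_N)},$$ where $K$ is the Gaussian kernel $K(u)=\frac1{\sqrt{2\pi}}e^{-u^2/2}$,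 the triangular kernel $K(u)=(1-u)\mathbb I\{u\le1\}$ or the Epanechnikov kernel $K(u)=\frac34(1-u^2)\mathbb I\{u\le1\}$. (2) There is $\sigma>0$ such that $\mathbb P\left(\|\xi\|-\mathbb E[\|\xi\|\mid\gamma=\bar\gamma]>t\mid\gamma=\bar\gamma\right)\le\exp\left(-\frac{t^2}{2\sigma^2}\right)$ for all $t>0$ and $\bar\gamma\in\Gamma$ (the conditional expectations being finite). (3) There is $0<L<\infty$ such that $\mathsf d_1(\mathbb P_{\bar\gamma},\mathbb P_{\bar\gamma'})\le L\|\bar\gamma-\bar\gamma'\|$ for all $\bar\gamma,\bar\gamma'\in\Gamma$. (4) $\Gamma$ is compact, and there is $g>0$ such that $\mathbb P(\|\gamma-\bar\gamma\|\le\epsilon)\ge g\,\epsilon^{d_\gamma}$ for all $\epsilon\in(0,1]$ and $\bar\gamma\in\Gamma$. Then, for every $\bar\gamma\in\Gamma$, the empirical conditional measure $\hat{\mathbb P}^N_{\bar\gamma}=\sum_{i=1}^Nw_N^i(\bar\gamma)\,\delta_{\xi^i}$ satisfies $$\mathbb P^\infty\left(\left\{\mathsf d_1(\mathbb P_{\bar\gamma},\hat{\mathbb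 P}^N_{\bar\gamma})>\epsilon_N\right\}\text{ i.o.}\right)=0.$$ -/

import Mathlib

open MeasureTheory ProbabilityTheory Filter Set
open scoped ENNReal Topology

noncomputable section

namespace SideInfo

/-- `ℝ^d` equipped with the `ℓ_r` norm (and its Borel σ-algebra). -/
abbrev Vec (r : ℝ≥0∞) (d : ℕ) : Type := PiLp r (fun _ : Fin d => ℝ)

/-! ### The type-1 Wasserstein distance -/

/-- `π` is a joint distribution with marginals `Q` and `Q'`. -/
def IsCoupling {E : Type*} [MeasurableSpace E] (Q Q' : Measure E) (π : Measure (E × E)) : Prop :=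
  π.map Prod.fst = Q ∧ π.map Prod.snd = Q'

/-- The type-1 Wasserstein distance: the infimum of `E ‖ξ - ξ'‖` over all joint distributions of
`(ξ, ξ')` with marginals `Q` and `Q'`, as an extended nonnegative real. -/
def wasserstein1 {E : Type*} [NormedAddCommGroup E] [MeasurableSpace E] (Q Q' : Measure E) :
    ℝ≥0∞ :=
  ⨅ (π : Measure (E × E)) (_ : IsCoupling Q Q' π), ∫⁻ z, ENNReal.ofReal ‖z.1 - z.2‖ ∂π

/-! ### Weight functions -/

/-- A family of weight functions: `w N g x i` is the weight given to the `i`-th of the `N` training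
samples for the new side information `x`, when the side information observed in the training
samples is `g 0, …, g (N - 1)`. -/
abbrev WeightFamily (G : Type*) : Type _ := (N : ℕ) → (Fin N → G) → G → Fin N → ℝ

/-- Sample `j` is closer to `x` than sample `i`; ties are broken in favour of the smaller index. -/
def Closer {G : Type*} [NormedAddCommGroup G] {N : ℕ} (g : Fin N → G) (x : G) (j i : Fin N) :
    Prop :=
  ‖g j - x‖ < ‖g i - x‖ ∨ (‖g j - x‖ = ‖g i - x‖ ∧ j < i)

/-- `g i` is a `k`-nearest neighbor of `x` among `g 0, …, g (N - 1)`: fewer than `k` of the other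
samples are closer to `x`. -/
def IsNearestNeighbor {G : Type*} [NormedAddCommGroup G] {N : ℕ} (k : ℕ) (g : Fin N → G) (x : G)
    (i : Fin N) : Prop :=
  {j : Fin N | j ≠ i ∧ Closer g x j i}.ncard < k

open scoped Classical in
/-- The `k`-nearest neighbor weights. -/
def knnWeight {G : Type*} [NormedAddCommGroup G] {N : ℕ} (k : ℕ) (g : Fin N → G) (x : G)
    (i : Fin N) : ℝ :=
  if IsNearestNeighbor k g x i then 1 / (k : ℝ) else 0

/-- The Gaussian kernel. -/
def gaussianKernel (u : ℝ) : ℝ := 1 / Real.sqrt (2 * Real.pi) * Real.exp (-u ^ 2 / 2)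

/-- The triangular kernel (it is only evaluated at `u ≥ 0`). -/
def triangularKernel (u : ℝ) : ℝ := if u ≤ 1 then 1 - u else 0

/-- The Epanechnikov kernel (it is only evaluated at `u ≥ 0`). -/
def epanechnikovKernel (u : ℝ) : ℝ := if u ≤ 1 then 3 / 4 * (1 - u ^ 2) else 0

/-- The kernel regression weights with kernel `K` and bandwidth `h`. -/
def kernelWeight {G : Type*} [NormedAddCommGroup G] {N : ℕ} (K : ℝ → ℝ) (h : ℝ) (g : Fin N → G)
    (x : G) (i : Fin N) : ℝ :=
  K (‖g i - x‖ / h) / ∑ j, K (‖g j - x‖ / h)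

/-- Nearest neighbor parameter choice: the weights are the `k_N`-nearest neighbor weights with
`k_N = min (⌈k₃ N^δ⌉, N - 1)`, and `ε_N = k₁ / N^p`. -/
def KnnChoice {G : Type*} [NormedAddCommGroup G] (dγ dξ : ℕ) (w : WeightFamily G) (ε : ℕ → ℝ) :
    Prop :=
  ∃ k₁ k₃ δ p : ℝ, 0 < k₁ ∧ 0 < k₃ ∧ 1 / 2 < δ ∧ δ < 1 ∧
    0 < p ∧ p < min ((1 - δ) / dγ) ((2 * δ - 1) / (dξ + 2)) ∧
    ∀ N : ℕ, 1 ≤ N →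
      ε N = k₁ / (N : ℝ) ^ p ∧
      ∀ (g : Fin N → G) (x : G) (i : Fin N),
        w N g x i = knnWeight (min ⌈k₃ * (N : ℝ) ^ δ⌉₊ (N - 1)) g x i

/-- Kernel regression parameter choice: the weights are the kernel regression weights with the
Gaussian, triangular or Epanechnikov kernel and bandwidth `h_N = k₄ N^(-δ)`, and
`ε_N = k₁ / N^p`. -/
def KernelChoice {G : Type*} [NormedAddCommGroup G] (dγ dξ : ℕ) (w : WeightFamily G)
    (ε : ℕ → ℝ) : Prop :=
  ∃ (K : ℝ → ℝ) (k₁ k₄ δ p : ℝ),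
    (K = gaussianKernel ∨ K = triangularKernel ∨ K = epanechnikovKernel) ∧
    0 < k₁ ∧ 0 < k₄ ∧ 0 < δ ∧ δ < 1 / (2 * dγ) ∧
    0 < p ∧ p < min δ ((1 - δ * dγ) / (2 + dξ)) ∧
    ∀ N : ℕ, 1 ≤ N →
      ε N = k₁ / (N : ℝ) ^ p ∧
      ∀ (g : Fin N → G) (x : G) (i : Fin N),
        w N g x i = kernelWeight K (k₄ * (N : ℝ) ^ (-δ)) g x i

/-! ### Assumptions on the joint distribution

`κ x` is the conditional distribution of `ξ` given `γ = x`. -/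

/-- Conditional subgaussianity of `‖ξ‖`. (Integrability makes the conditional expectation
meaningful.) -/
def ConditionallySubgaussian {G E : Type*} [MeasurableSpace G] [NormedAddCommGroup E]
    [MeasurableSpace E] (Γ : Set G) (κ : Kernel G E) : Prop :=
  ∃ σ : ℝ, 0 < σ ∧ ∀ x ∈ Γ, Integrable (fun y => ‖y‖) (κ x) ∧
    ∀ t : ℝ, 0 < t →
      (κ x).real {y | ‖y‖ - ∫ y', ‖y'‖ ∂(κ x) > t} ≤ Real.exp (-t ^ 2 / (2 * σ ^ 2))

/-- Lipschitz continuity of the conditional distribution in the Wasserstein distance. -/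
def WassersteinLipschitz {G E : Type*} [NormedAddCommGroup G] [MeasurableSpace G]
    [NormedAddCommGroup E] [MeasurableSpace E] (Γ : Set G) (κ : Kernel G E) : Prop :=
  ∃ L : ℝ, 0 < L ∧ ∀ x ∈ Γ, ∀ x' ∈ Γ,
    wasserstein1 (κ x) (κ x') ≤ ENNReal.ofReal (L * ‖x - x'‖)

/-- Smoothness of the side information: `Γ` is compact and small balls centred in `Γ` have
probability at least of the order of the radius to the power of the dimension. (The radius is
restricted to `(0, 1]`; for large radii no probability satisfies the bound.) -/
def SmoothSideInformation {G E : Type*} [NormedAddCommGroup G] [MeasurableSpace G]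
    [MeasurableSpace E] (dγ : ℕ) (Γ : Set G) (μ : Measure (G × E)) : Prop :=
  IsCompact Γ ∧ ∃ g : ℝ, 0 < g ∧ ∀ e : ℝ, 0 < e → e ≤ 1 → ∀ x ∈ Γ,
    g * e ^ dγ ≤ μ.real {z | ‖z.1 - x‖ ≤ e}

/-! ### The empirical conditional measure -/

/-- The empirical conditional measure `∑ i, w_N^i(x) δ_{ξ^i}` built from the first `N` samples of
the sequence `ω` of observations `(γ, ξ)`. -/
def empiricalConditional {G E : Type*} [MeasurableSpace E] (w : WeightFamily G) (N : ℕ) (x : G)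
    (ω : ℕ → G × E) : Measure E :=
  ∑ i : Fin N, ENNReal.ofReal (w N (fun j : Fin N => (ω j).1) x i) • Measure.dirac (ω i).2

end SideInfo

end

/-! Conditionally on the side information, the `ξ^i` are independent with laws `κ (γ^i)` and the
weights are constants. The mixture `∑ w_i κ (γ^i)` therefore splits the error in two. The bias, from
`κ x` to the mixture, is at most `L ∑ w_i ‖γ^i - x‖` by the Lipschitz assumption
(`wasserstein1_mixture_le_of_lipschitz`).

The fluctuation, from the mixture to `∑ w_i δ_{ξ^i}`, is handled by truncating to a ball of radius
`R` and rounding to a grid of mesh `η` (`wasserstein1_mixture_le_of_cells`). Two measures on the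
grid are close as soon as they nearly agree on every union of cells. Hoeffding and a union bound
over the `2 ^ #cells` unions control this (`measure_deviationSet_le`), and uniform exponential
moments control the tails.

If the weights are at most of order `N ^ (-s)`, then mesh, radius and deviation can be powers of `N`
making the failure probabilities summable and the fluctuation `o(N ^ (-p))`, provided `p (dξ + 2) <
s`. With Borel-Cantelli this gives `ae_eventually_wasserstein1_le`.

It remains to bound weights and bias. By `ae_eventually_le_card_ball`, slowly shrinking balls around
`x` contain many samples. So the nearest neighbors lie close to `x` with `s = δ`, and the kernel
denominators are of order at least `N ^ (1 - δ dγ)`, giving `s = 1 - δ dγ`. -/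

namespace SideInfo

/-! ### Couplings and the Wasserstein distance. -/

section Wasserstein

theorem map_sum_smul {X Y ι : Type*} [MeasurableSpace X] [MeasurableSpace Y] [Fintype ι]
    (a : ι → ℝ≥0∞) (Q : ι → Measure X) {f : X → Y} (hf : Measurable f) :
    (∑ i, a i • Q i).map f = ∑ i, a i • (Q i).map f := by
  simp_rw [← Measure.mapₗ_apply_of_measurable hf, map_sum, map_smul]

theorem isCoupling_swap {E : Type*} [MeasurableSpace E] {Q Q' : Measure E} {π : Measure (E × E)}
    (h : IsCoupling Q Q' π) :
    IsCoupling Q' Q (π.map Prod.swap) := by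
  constructor
  · rw [Measure.map_map measurable_fst measurable_swap]
    exact h.2
  · rw [Measure.map_map measurable_snd measurable_swap]
    exact h.1

variable {E : Type*} [NormedAddCommGroup E] [MeasurableSpace E]

theorem wasserstein1_le_of_isCoupling {Q Q' : Measure E} {π : Measure (E × E)}
    (h : IsCoupling Q Q' π) :
    wasserstein1 Q Q' ≤ ∫⁻ z, ENNReal.ofReal ‖z.1 - z.2‖ ∂π :=
  iInf₂_le π h

/-- Mixing couplings of `P` with each `Q i` couples `P` with the mixture. The bounds are strict
because the infimum need not be attained, so only near-optimal couplings are chosen. -/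
theorem wasserstein1_mixture_le {ι : Type*} [Fintype ι] {P : Measure E} {Q : ι → Measure E}
    {a b : ι → ℝ≥0∞} (ha : ∑ i, a i = 1) (h : ∀ i, wasserstein1 P (Q i) < b i) :
    wasserstein1 P (∑ i, a i • Q i) ≤ ∑ i, a i * b i := by
  have h' : ∀ i, ∃ π, IsCoupling P (Q i) π ∧
      ∫⁻ z, ENNReal.ofReal ‖z.1 - z.2‖ ∂π < b i := by
    intro i
    have := h i
    unfold wasserstein1 at this
    simpa [iInf_lt_iff] using this
  choose π hπ hlt using h'
  have hc : IsCoupling P (∑ i, a i • Q i) (∑ i, a i • π i) := by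
    constructor
    · simp only [map_sum_smul _ _ measurable_fst, (hπ _).1]
      rw [← Finset.sum_smul, ha, one_smul]
    · simp only [map_sum_smul _ _ measurable_snd, (hπ _).2]
  refine (wasserstein1_le_of_isCoupling hc).trans ?_
  rw [lintegral_finsetSum_measure]
  refine Finset.sum_le_sum fun i _ => ?_
  rw [lintegral_smul_measure]
  exact mul_le_mul_right (hlt i).le _

variable [BorelSpace E]

/-- Carries a bound on the conditional mean norm from one point of `Γ` to all others. -/
theorem lintegral_norm_le_add_wasserstein1 (Q Q' : Measure E) :
    ∫⁻ y, ENNReal.ofReal ‖y‖ ∂Q' ≤ ∫⁻ y, ENNReal.ofReal ‖y‖ ∂Q + wasserstein1 Q Q' := by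
  unfold wasserstein1
  simp only [ENNReal.add_iInf]
  refine le_iInf₂ fun π h => ?_
  have hn : Measurable fun y : E => ENNReal.ofReal ‖y‖ := by fun_prop
  rw [← h.1, ← h.2, lintegral_map hn measurable_snd, lintegral_map hn measurable_fst,
    ← lintegral_add_left (by fun_prop)]
  refine lintegral_mono fun z => ?_
  rw [← ENNReal.ofReal_add (norm_nonneg _) (norm_nonneg _)]
  refine ENNReal.ofReal_le_ofReal ?_
  have := norm_sub_norm_le z.2 z.1
  rw [norm_sub_rev] at this
  linarith

variable [SecondCountableTopology E]

theorem measurable_transportCost :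
    Measurable fun z : E × E => ENNReal.ofReal ‖z.1 - z.2‖ := by
  fun_prop

theorem wasserstein1_comm_le (Q Q' : Measure E) : wasserstein1 Q Q' ≤ wasserstein1 Q' Q := by
  refine le_iInf₂ fun π h => (wasserstein1_le_of_isCoupling (isCoupling_swap h)).trans ?_
  rw [lintegral_map measurable_transportCost measurable_swap]
  simp [norm_sub_rev]

theorem wasserstein1_map_le (Q : Measure E) {T : E → E} (hT : Measurable T) :
    wasserstein1 Q (Q.map T) ≤ ∫⁻ y, ENNReal.ofReal ‖y - T y‖ ∂Q := by
  have hm : Measurable fun y => (y, T y) := measurable_id.prodMk hT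
  have h : IsCoupling Q (Q.map T) (Q.map fun y => (y, T y)) := by
    constructor
    · rw [Measure.map_map measurable_fst hm]
      exact Measure.map_id
    · rw [Measure.map_map measurable_snd hm]
      rfl
  refine (wasserstein1_le_of_isCoupling h).trans ?_
  rw [lintegral_map measurable_transportCost hm]

/-- The triangle inequality, by gluing couplings along their common marginal. -/
theorem wasserstein1_triangle [StandardBorelSpace E] (P Q R : Measure E) [IsProbabilityMeasure Q] :
    wasserstein1 P R ≤ wasserstein1 P Q + wasserstein1 Q R := by
  unfold wasserstein1
  simp only [ENNReal.iInf_add, ENNReal.add_iInf]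
  refine le_iInf₂ fun π₂ h₂ => le_iInf₂ fun π₁ h₁ => ?_
  have : IsProbabilityMeasure π₁ := by
    constructor
    rw [← Set.preimage_univ (f := Prod.snd), ← Measure.map_apply measurable_snd .univ, h₁.2,
      measure_univ]
  have : IsProbabilityMeasure π₂ := by
    constructor
    rw [← Set.preimage_univ (f := Prod.fst), ← Measure.map_apply measurable_fst .univ, h₂.1,
      measure_univ]
  have hfst : π₂.fst = Q := h₂.1
  have hdis : Q ⊗ₘ π₂.condKernel = π₂ := by
    rw [← hfst]; exact π₂.disintegrate _
  -- Given the middle point, the third point is drawn from the conditional law of `π₂`,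
  -- independently of the first.
  set η : Kernel (E × E) E := π₂.condKernel.comap Prod.snd measurable_snd with hη
  set ρ : Measure ((E × E) × E) := π₁ ⊗ₘ η with hρ
  have hρ₁ : ρ.map Prod.fst = π₁ := Measure.fst_compProd _ _
  have hρ₂ : ρ.map (fun z => (z.1.2, z.2)) = π₂ := by
    have hm : Measurable fun z : (E × E) × E => (z.1.2, z.2) := by fun_prop
    refine Measure.ext fun s hs => ?_
    rw [Measure.map_apply hm hs, hρ, Measure.compProd_apply (hm hs)]
    conv_rhs => rw [← hdis, Measure.compProd_apply hs, ← h₁.2]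
    rw [lintegral_map (Kernel.measurable_kernel_prodMk_left hs) measurable_snd]
    rfl
  have hm13 : Measurable fun z : (E × E) × E => (z.1.1, z.2) := by fun_prop
  have hc : IsCoupling P R (ρ.map fun z => (z.1.1, z.2)) := by
    constructor
    · rw [Measure.map_map measurable_fst hm13, ← h₁.1, ← hρ₁,
        Measure.map_map measurable_fst measurable_fst]
      rfl
    · rw [Measure.map_map measurable_snd hm13, ← h₂.2, ← hρ₂,
        Measure.map_map measurable_snd (by fun_prop)]
      rfl
  refine (wasserstein1_le_of_isCoupling hc).trans ?_
  rw [lintegral_map measurable_transportCost hm13]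
  conv_rhs => rw [← hρ₁, ← hρ₂]
  rw [lintegral_map measurable_transportCost measurable_fst,
    lintegral_map measurable_transportCost (by fun_prop),
    ← lintegral_add_left (by fun_prop)]
  refine lintegral_mono fun z => ?_
  rw [← ENNReal.ofReal_add (norm_nonneg _) (norm_nonneg _)]
  exact ENNReal.ofReal_le_ofReal (norm_sub_le_norm_sub_add_norm_sub _ _ _)

/-- Two distributions on the same finite set of atoms, coupled by keeping their common part in
place. -/
theorem wasserstein1_sum_dirac_le {ι : Type*} [Fintype ι] (c : ι → E) {D t : ℝ}
    (hD : ∀ i j, ‖c i - c j‖ ≤ D) {q q' : ι → ℝ} (hq : ∀ i, 0 ≤ q i) (hq' : ∀ i, 0 ≤ q' i)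
    (hsum : ∑ i, q i = ∑ i, q' i) (hD₀ : 0 ≤ D)
    (ht : ∀ S : Finset ι, ∑ i ∈ S, (q i - q' i) ≤ t) :
    wasserstein1 (∑ i, ENNReal.ofReal (q i) • Measure.dirac (c i))
      (∑ i, ENNReal.ofReal (q' i) • Measure.dirac (c i)) ≤ ENNReal.ofReal (D * t) := by
  classical
  set u : ι → ℝ := fun i => max (q i - q' i) 0 with hu
  set v : ι → ℝ := fun i => max (q' i - q i) 0 with hv
  have hu₀ : ∀ i, 0 ≤ u i := fun i => le_max_right _ _
  have hv₀ : ∀ i, 0 ≤ v i := fun i => le_max_right _ _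
  have huq : ∀ i, min (q i) (q' i) + u i = q i := by
    intro i; simp only [hu]
    rcases le_total (q i) (q' i) with h | h
    · rw [min_eq_left h, max_eq_right (by linarith)]; ring
    · rw [min_eq_right h, max_eq_left (by linarith)]; ring
  have hvq : ∀ i, min (q i) (q' i) + v i = q' i := by
    intro i; simp only [hv]
    rcases le_total (q i) (q' i) with h | h
    · rw [min_eq_left h, max_eq_left (by linarith)]; ring
    · rw [min_eq_right h, max_eq_right (by linarith)]; ring
  set m : ℝ := ∑ i, u i with hm
  have hmv : m = ∑ i, v i := by
    have h1 : ∑ i, (min (q i) (q' i) + u i) = ∑ i, q i := Finset.sum_congr rfl fun i _ => huq i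
    have h2 : ∑ i, (min (q i) (q' i) + v i) = ∑ i, q' i := Finset.sum_congr rfl fun i _ => hvq i
    rw [Finset.sum_add_distrib] at h1 h2
    linarith
  have hm₀ : 0 ≤ m := Finset.sum_nonneg fun i _ => hu₀ i
  -- The total excess mass is attained on the set where `q' ≤ q`, so a one-sided bound over all
  -- subsets controls it.
  have hmt : m ≤ t := by
    refine le_trans (le_of_eq ?_) (ht (Finset.univ.filter fun i => q' i ≤ q i))
    rw [hm, Finset.sum_filter]
    refine Finset.sum_congr rfl fun i _ => ?_
    simp only [hu]
    split_ifs with h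
    · exact max_eq_left (by linarith)
    · exact max_eq_right (by linarith)
  -- If `m = 0`, all excesses vanish, so the value `0` of division by zero is the right one.
  have huv : ∀ i, ∑ j, u i * v j / m = u i := by
    intro i
    rcases hm₀.eq_or_lt with h | h
    · have : u i = 0 := (Finset.sum_eq_zero_iff_of_nonneg fun i _ => hu₀ i).1 h.symm i (by simp)
      simp [this]
    · rw [← Finset.sum_div, ← Finset.mul_sum, ← hmv]
      field_simp
  have hvu : ∀ j, ∑ i, u i * v j / m = v j := by
    intro j
    rcases hm₀.eq_or_lt with h | h
    · have : v j = 0 :=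
        (Finset.sum_eq_zero_iff_of_nonneg fun i _ => hv₀ i).1 (hmv ▸ h.symm) j (by simp)
      simp [this]
    · rw [← Finset.sum_div, ← Finset.sum_mul, ← hm]
      field_simp
  -- Common mass stays on the diagonal at no cost; the excess `u` is sent to the deficit `v` by the
  -- normalized product coupling, at distance at most `D`.
  set θ : ι × ι → ℝ := fun k =>
    (if k.1 = k.2 then min (q k.1) (q' k.1) else 0) + u k.1 * v k.2 / m with hθ
  have hθ₀ : ∀ k, 0 ≤ θ k := by
    intro k
    refine add_nonneg ?_ (div_nonneg (mul_nonneg (hu₀ _) (hv₀ _)) hm₀)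
    split_ifs
    · exact le_min (hq _) (hq' _)
    · exact le_rfl
  set π : Measure (E × E) := ∑ k, ENNReal.ofReal (θ k) • Measure.dirac (c k.1, c k.2) with hπ
  have hc : IsCoupling (∑ i, ENNReal.ofReal (q i) • Measure.dirac (c i))
      (∑ i, ENNReal.ofReal (q' i) • Measure.dirac (c i)) π := by
    constructor
    · simp only [hπ, map_sum_smul _ _ measurable_fst, Measure.map_dirac' measurable_fst]
      rw [Fintype.sum_prod_type]
      refine Finset.sum_congr rfl fun i _ => ?_
      dsimp only
      rw [← Finset.sum_smul, ← ENNReal.ofReal_sum_of_nonneg fun j _ => hθ₀ (i, j)]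
      simp only [hθ, Finset.sum_add_distrib, huv]
      simp [huq]
    · simp only [hπ, map_sum_smul _ _ measurable_snd, Measure.map_dirac' measurable_snd]
      rw [Fintype.sum_prod_type_right]
      refine Finset.sum_congr rfl fun j _ => ?_
      dsimp only
      rw [← Finset.sum_smul, ← ENNReal.ofReal_sum_of_nonneg fun i _ => hθ₀ (i, j)]
      simp only [hθ, Finset.sum_add_distrib, hvu]
      simp [hvq]
  refine (wasserstein1_le_of_isCoupling hc).trans ?_
  rw [hπ, lintegral_finsetSum_measure]
  simp only [lintegral_smul_measure, lintegral_dirac' _ measurable_transportCost, smul_eq_mul,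
    ← ENNReal.ofReal_mul (hθ₀ _)]
  rw [← ENNReal.ofReal_sum_of_nonneg fun k _ => mul_nonneg (hθ₀ k) (norm_nonneg _)]
  refine ENNReal.ofReal_le_ofReal ?_
  calc ∑ k : ι × ι, θ k * ‖c k.1 - c k.2‖
      ≤ ∑ k : ι × ι, u k.1 * v k.2 / m * D := by
        refine Finset.sum_le_sum fun k _ => ?_
        simp only [hθ]
        have h0 : 0 ≤ u k.1 * v k.2 / m := div_nonneg (mul_nonneg (hu₀ _) (hv₀ _)) hm₀
        split_ifs with h
        · rw [h, sub_self, norm_zero, mul_zero]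
          exact mul_nonneg (h ▸ h0) hD₀
        · rw [zero_add]
          exact mul_le_mul_of_nonneg_left (hD _ _) h0
    _ = m * D := by
        rw [← Finset.sum_mul, Fintype.sum_prod_type]
        rw [Finset.sum_congr rfl fun i _ => huv i]
    _ ≤ D * t := by nlinarith

end Wasserstein

/-! ### Grids in `ℓ_r` balls. -/

section Grid

variable {r : ℝ≥0∞} [Fact (1 ≤ r)] {d : ℕ}

theorem norm_le_sum_abs (y : Vec r d) : ‖y‖ ≤ ∑ k, |y k| := by
  have h : y = ∑ k, PiLp.single r k (y k) := by
    ext j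
    simp
  calc ‖y‖ = ‖∑ k, PiLp.single r k (y k)‖ := congrArg _ h
    _ ≤ ∑ k, ‖PiLp.single r (β := fun _ : Fin d => ℝ) k (y k)‖ := norm_sum_le _ _
    _ = ∑ k, |y k| := by
        refine Finset.sum_congr rfl fun k _ => ?_
        rw [PiLp.norm_single, Real.norm_eq_abs]

/-- A crude comparison valid for every `r` at once; the dimensional factor does not affect the
rates. -/
theorem norm_le_card_mul {y : Vec r d} {a : ℝ} (h : ∀ k, |y k| ≤ a) : ‖y‖ ≤ d * a := by
  refine (norm_le_sum_abs y).trans ((Finset.sum_le_sum fun k _ => h k).trans ?_)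
  simp

/-- A finite grid of mesh `η` for the ball of radius `R`, with a measurable rounding map. -/
theorem exists_grid {R η : ℝ} (hη : 0 < η) (hR : 0 ≤ R) :
    ∃ (m : ℕ) (c : (Fin d → Fin m) → Vec r d) (cell : Vec r d → (Fin d → Fin m)),
      Measurable cell ∧ (m : ℝ) ≤ 2 * (R / η) + 3 ∧ (∀ j, ‖c j‖ ≤ d * (R + η)) ∧
      ∀ y, ‖y‖ ≤ R → ‖y - c (cell y)‖ ≤ d * η := by
  set n : ℕ := ⌈R / η⌉₊ with hn
  have hn1 : (n : ℝ) < R / η + 1 := Nat.ceil_lt_add_one (by positivity)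
  have hn2 : R / η ≤ n := Nat.le_ceil _
  have hηn : η * n ≤ R + η := by
    have := mul_le_mul_of_nonneg_left hn1.le hη.le
    rw [mul_add, mul_div_cancel₀ _ hη.ne', mul_one] at this
    exact this
  -- Coordinates are rounded down to multiples of `η`, with indices shifted by `n` and clamped to
  -- `0, …, 2 n`. The clamping is inactive inside the ball.
  refine ⟨2 * n + 1, fun j => WithLp.toLp r fun k => η * ((j k : ℕ) - n : ℝ),
    fun y k => ⟨min (⌊y k / η⌋ + n).toNat (2 * n), by omega⟩, ?_, ?_, ?_, ?_⟩
  · refine measurable_pi_lambda _ fun k => ?_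
    have h1 : Measurable fun y : Vec r d => ⌊y k / η⌋ := by fun_prop
    exact (measurable_of_countable (fun z : ℤ => (⟨min (z + n).toNat (2 * n), by omega⟩ :
      Fin (2 * n + 1)))).comp h1
  · push_cast
    linarith
  · intro j
    refine norm_le_card_mul fun k => le_trans ?_ hηn
    rw [PiLp.toLp_apply, abs_mul, abs_of_pos hη]
    refine mul_le_mul_of_nonneg_left ?_ hη.le
    have : ((j k : ℕ) : ℝ) ≤ 2 * n := by exact_mod_cast Nat.lt_succ_iff.1 (j k).2
    rw [abs_le]
    constructor
    · have : (0 : ℝ) ≤ (j k : ℕ) := Nat.cast_nonneg _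
      linarith
    · linarith
  · intro y hy
    refine norm_le_card_mul fun k => ?_
    have hk : |y k| ≤ R := (PiLp.norm_apply_le y k).trans hy
    rw [abs_le] at hk
    have h1 : -(n : ℤ) ≤ ⌊y k / η⌋ := by
      rw [Int.le_floor]
      push_cast
      have : -(R / η) ≤ y k / η := by
        rw [← neg_div]; exact div_le_div_of_nonneg_right hk.1 hη.le
      linarith
    have h2 : ⌊y k / η⌋ ≤ n := by
      have : y k / η ≤ R / η := div_le_div_of_nonneg_right hk.2 hη.le
      have h3 := (Int.floor_le (y k / η)).trans (this.trans hn2)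
      rw [← Int.cast_natCast (R := ℝ), Int.cast_le] at h3
      exact h3
    have h3 : ((min (⌊y k / η⌋ + n).toNat (2 * n) : ℕ) : ℤ) = ⌊y k / η⌋ + n := by omega
    have h4 : ((min (⌊y k / η⌋ + n).toNat (2 * n) : ℕ) : ℝ) = ⌊y k / η⌋ + n := by
      exact_mod_cast h3
    have h5 : (y - WithLp.toLp r (fun k => η * (((⟨min (⌊y k / η⌋ + n).toNat (2 * n), by omega⟩ :
        Fin (2 * n + 1)) : ℕ) - n : ℝ)) : Vec r d) k = y k - η * ⌊y k / η⌋ := by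
      rw [PiLp.sub_apply, PiLp.toLp_apply]
      simp only [h4]
      ring
    rw [h5]
    have h6 := Int.floor_le (y k / η)
    have h7 := Int.lt_floor_add_one (y k / η)
    rw [le_div_iff₀ hη] at h6
    rw [div_lt_iff₀ hη] at h7
    rw [abs_le]
    constructor <;> nlinarith

end Grid

/-! ### Product measures and conditional independence. -/

section Product

theorem infinitePi_map_fin {Z : Type*} [MeasurableSpace Z] (μ : Measure Z) [IsProbabilityMeasure μ]
    (N : ℕ) :
    (Measure.infinitePi fun _ : ℕ => μ).map (fun ω (i : Fin N) => ω i) =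
      Measure.pi fun _ : Fin N => μ := by
  classical
  symm
  refine Measure.pi_eq fun s hs => ?_
  rw [Measure.map_apply (by fun_prop) (.univ_pi hs)]
  have h : (fun (ω : ℕ → Z) (i : Fin N) => ω i) ⁻¹' univ.pi s =
      ((Finset.range N : Finset ℕ) : Set ℕ).pi
        (fun n => if h : n < N then s ⟨n, h⟩ else univ) := by
    ext ω
    simp only [mem_preimage, Set.mem_pi, Finset.coe_range, mem_Iio]
    constructor
    · intro h n hn
      rw [dif_pos hn]
      exact h ⟨n, hn⟩ (mem_univ _)
    · intro h i _
      have := h i i.2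
      rwa [dif_pos i.2] at this
  rw [h, Measure.infinitePi_pi]
  · rw [Finset.prod_range]
    simp
  · intro n hn
    rw [dif_pos (Finset.mem_range.1 hn)]
    exact hs _

theorem lintegral_pi_prod {ι X : Type*} [Fintype ι] [MeasurableSpace X] (ν : Measure X)
    [IsProbabilityMeasure ν] {f : ι → X → ℝ≥0∞} (hf : ∀ i, Measurable (f i)) :
    ∫⁻ x, ∏ i, f i (x i) ∂(Measure.pi fun _ : ι => ν) = ∏ i, ∫⁻ x, f i x ∂ν := by
  have hind : iIndepFun (fun i (x : ι → X) => f i (x i)) (Measure.pi fun _ : ι => ν) :=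
    iIndepFun_pi fun i => (hf i).aemeasurable
  rw [lintegral_prod_eq_prod_lintegral_of_indepFun Finset.univ _ hind
    fun i => (hf i).comp (measurable_pi_apply i)]
  refine Finset.prod_congr rfl fun i _ => ?_
  exact (measurePreserving_eval (fun _ : ι => ν) i).lintegral_comp (hf i)

variable {X Y : Type*} [MeasurableSpace X] [MeasurableSpace Y]

/-- The kernel sending a vector of points to the product of the distributions at these points. -/
noncomputable def piKernel (ι : Type*) [Fintype ι] (κ : Kernel X Y) [IsMarkovKernel κ] :
    Kernel (ι → X) (ι → Y) where
  toFun x := Measure.pi fun i => κ (x i)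
  measurable' := by
    refine Measurable.measure_of_isPiSystem_of_isProbabilityMeasure generateFrom_pi.symm
      isPiSystem_pi ?_
    rintro _ ⟨s, hs, rfl⟩
    simp only [Measure.pi_pi]
    refine Finset.measurable_prod _ fun i _ => ?_
    exact (κ.measurable_coe (hs i (mem_univ i))).comp (measurable_pi_apply i)

theorem piKernel_apply (ι : Type*) [Fintype ι] (κ : Kernel X Y) [IsMarkovKernel κ] (x : ι → X) :
    piKernel ι κ x = Measure.pi fun i => κ (x i) := rfl

instance (ι : Type*) [Fintype ι] (κ : Kernel X Y) [IsMarkovKernel κ] :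
    IsMarkovKernel (piKernel ι κ) :=
  ⟨fun x => by rw [piKernel_apply]; infer_instance⟩

/-- Independent pairs: first draw all first components, then, independently given these, the
second components. -/
theorem pi_compProd (ι : Type*) [Fintype ι] (ν : Measure X) [IsProbabilityMeasure ν]
    (κ : Kernel X Y) [IsMarkovKernel κ] :
    (Measure.pi fun _ : ι => ν ⊗ₘ κ) =
      ((Measure.pi fun _ : ι => ν) ⊗ₘ piKernel ι κ).map fun z i => (z.1 i, z.2 i) := by
  classical
  have hmeas : Measurable fun (z : (ι → X) × (ι → Y)) (i : ι) => (z.1 i, z.2 i) := by fun_prop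
  -- It suffices to compare on boxes of measurable rectangles, where both sides factor over the
  -- coordinates.
  refine (Measure.ext_of_generateFrom_of_iUnion
    (Set.pi univ '' Set.pi univ fun _ : ι =>
      image2 (· ×ˢ ·) {s : Set X | MeasurableSet s} {t : Set Y | MeasurableSet t})
    (fun _ => univ) ?_ ?_ ?_ ?_ ?_ ?_)
  · rw [generateFrom_eq_pi (C := fun _ : ι =>
      image2 (· ×ˢ ·) {s : Set X | MeasurableSet s} {t : Set Y | MeasurableSet t})
      (fun _ => generateFrom_prod)]
    exact fun _ => ⟨fun _ => univ, fun _ => ⟨univ, .univ, univ, .univ, univ_prod_univ⟩,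
      iUnion_const _⟩
  · exact IsPiSystem.pi fun _ => isPiSystem_prod
  · exact iUnion_const _
  · exact fun _ => ⟨fun _ => univ, fun _ _ => ⟨univ, .univ, univ, .univ, univ_prod_univ⟩,
      pi_univ _⟩
  · intro _
    exact measure_ne_top _ _
  · rintro _ ⟨S, hS, rfl⟩
    choose s hs t ht hst using fun i => hS i (mem_univ i)
    simp only [mem_ofPred_eq] at hs ht
    obtain rfl : S = fun i => s i ×ˢ t i := funext fun i => (hst i).symm
    have hmem : MeasurableSet (univ.pi fun i => s i ×ˢ t i) :=
      .univ_pi fun i => (hs i).prod (ht i)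
    rw [Measure.pi_pi, Measure.map_apply hmeas hmem, Measure.compProd_apply (hmeas hmem)]
    have hval : ∀ x : ι → X, piKernel ι κ x (Prod.mk x ⁻¹'
        ((fun (z : (ι → X) × (ι → Y)) (i : ι) => (z.1 i, z.2 i)) ⁻¹'
          univ.pi fun i => s i ×ˢ t i)) = ∏ i, (s i).indicator (fun x => κ x (t i)) (x i) := by
      intro x
      by_cases hx : ∀ i, x i ∈ s i
      · have : Prod.mk x ⁻¹' ((fun (z : (ι → X) × (ι → Y)) (i : ι) => (z.1 i, z.2 i)) ⁻¹'
            univ.pi fun i => s i ×ˢ t i) = univ.pi t := by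
          ext y
          simp [hx]
        rw [this, piKernel_apply, Measure.pi_pi]
        refine Finset.prod_congr rfl fun i _ => ?_
        rw [indicator_of_mem (hx i)]
      · have : Prod.mk x ⁻¹' ((fun (z : (ι → X) × (ι → Y)) (i : ι) => (z.1 i, z.2 i)) ⁻¹'
            univ.pi fun i => s i ×ˢ t i) = ∅ := by
          ext y
          simp only [mem_preimage, mem_univ_pi, mem_prod, mem_empty_iff_false, iff_false]
          exact fun h => hx fun i => (h i).1
        push Not at hx
        obtain ⟨i, hi⟩ := hx
        rw [this, measure_empty, Finset.prod_eq_zero (Finset.mem_univ i)]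
        rw [indicator_of_notMem hi]
    simp only [hval]
    rw [lintegral_pi_prod ν fun i => (κ.measurable_coe (ht i)).indicator (hs i)]
    refine Finset.prod_congr rfl fun i _ => ?_
    rw [Measure.compProd_apply_prod (hs i) (ht i), lintegral_indicator (hs i)]

end Product

/-! ### Weighted Hoeffding inequality. -/

section Hoeffding

/-- Hoeffding's inequality for weighted sums of independent `[0, 1]`-valued variables. -/
theorem measure_weighted_sum_ge_le {ι Y : Type*} [Fintype ι] [MeasurableSpace Y]
    (P : ι → Measure Y) [∀ i, IsProbabilityMeasure (P i)] {f : Y → ℝ} (hf : Measurable f)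
    (hf₀ : ∀ y, 0 ≤ f y) (hf₁ : ∀ y, f y ≤ 1) {a : ι → ℝ} {b t : ℝ} (ha₀ : ∀ i, 0 ≤ a i)
    (hab : ∀ i, a i ≤ b) (ha : ∑ i, a i = 1) (hb : 0 < b) (ht : 0 ≤ t) :
    (Measure.pi P).real {y | t ≤ ∑ i, a i * ((∫ z, f z ∂P i) - f (y i))} ≤
      Real.exp (-(2 * t ^ 2 / b)) := by
  -- A `[0, 1]`-valued variable has variance proxy `1 / 4`; the factor `-a i` turns a shortfall of
  -- the frequency into an upper deviation.
  have hsub : ∀ i, HasSubgaussianMGF (fun y : ι → Y => (-a i) * (f (y i) - ∫ z, f z ∂P i))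
      (Real.toNNReal (a i ^ 2) * (1 / 2) ^ 2) (Measure.pi P) := by
    intro i
    have h1 : HasSubgaussianMGF (fun y => f y - ∫ z, f z ∂P i) ((‖(1 : ℝ) - 0‖₊ / 2) ^ 2) (P i) :=
      hasSubgaussianMGF_of_mem_Icc hf.aemeasurable (ae_of_all _ fun y => ⟨hf₀ y, hf₁ y⟩)
    have h2 : HasSubgaussianMGF ((fun y => f y - ∫ z, f z ∂P i) ∘ fun y : ι → Y => y i)
        ((‖(1 : ℝ) - 0‖₊ / 2) ^ 2) (Measure.pi P) := by
      refine HasSubgaussianMGF.of_map (measurable_pi_apply i).aemeasurable ?_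
      rw [(measurePreserving_eval P i).map_eq]
      exact h1
    have h3 := h2.const_mul (-a i)
    convert h3 using 1
    · rfl
    refine NNReal.eq ?_
    change ((a i ^ 2).toNNReal : ℝ) * (1 / 2) ^ 2 = (-a i) ^ 2 * (‖(1 : ℝ) - 0‖ / 2) ^ 2
    rw [Real.coe_toNNReal _ (sq_nonneg _)]
    norm_num
  have hind : iIndepFun (fun i (y : ι → Y) => (-a i) * (f (y i) - ∫ z, f z ∂P i))
      (Measure.pi P) :=
    iIndepFun_pi (X := fun i y => (-a i) * (f y - ∫ z, f z ∂P i)) fun i => by fun_prop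
  have h := HasSubgaussianMGF.measure_sum_ge_le_of_iIndepFun hind (s := Finset.univ)
    (fun i _ => hsub i) ht
  have heq : {y : ι → Y | t ≤ ∑ i, a i * ((∫ z, f z ∂P i) - f (y i))} =
      {y | t ≤ ∑ i, (-a i) * (f (y i) - ∫ z, f z ∂P i)} := by
    ext y
    simp only [mem_ofPred_eq]
    rw [Finset.sum_congr rfl fun i _ => ?_]
    ring
  rw [heq]
  refine h.trans (Real.exp_le_exp.2 ?_)
  have hs : ((∑ i, Real.toNNReal (a i ^ 2) * (1 / 2) ^ 2 : NNReal) : ℝ) = (∑ i, a i ^ 2) / 4 := by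
    push_cast
    rw [Finset.sum_div]
    refine Finset.sum_congr rfl fun i _ => ?_
    rw [Real.coe_toNNReal _ (sq_nonneg _)]
    ring
  rw [hs]
  -- The weights sum to one, so the largest weight controls the total variance proxy, `∑ a_i ^ 2 /
  -- 4`.
  have hle : ∑ i, a i ^ 2 ≤ b := by
    calc ∑ i, a i ^ 2 ≤ ∑ i, b * a i := Finset.sum_le_sum fun i _ => by
          rw [sq]; exact mul_le_mul_of_nonneg_right (hab i) (ha₀ i)
      _ = b := by rw [← Finset.mul_sum, ha, mul_one]
  have hpos : 0 < ∑ i, a i ^ 2 := by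
    by_contra hcon
    have h0 : ∑ i, a i ^ 2 = 0 := le_antisymm (not_lt.1 hcon)
      (Finset.sum_nonneg fun i _ => sq_nonneg _)
    have h1 : ∀ i, a i = 0 := fun i => by
      have := (Finset.sum_eq_zero_iff_of_nonneg fun i _ => sq_nonneg (a i)).1 h0 i (by simp)
      simpa using this
    simp [h1] at ha
  rw [neg_div, neg_le_neg_iff, div_le_div_iff₀ hb (by positivity)]
  nlinarith [sq_nonneg t]

end Hoeffding

/-! ### Uniform exponential moments and tail bounds. -/

section Tails

variable {E : Type*} [NormedAddCommGroup E] [MeasurableSpace E] [BorelSpace E]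

/-- On the shell `j < ‖y‖ ≤ j + 1` the integrand is at most `exp ((j + 1) / 2)`, and the tail `C exp
(-j)` leaves a geometric series. -/
theorem lintegral_exp_norm_le (Q : Measure E) [IsProbabilityMeasure Q] {C : ℝ} (hC : 0 ≤ C)
    (h : ∀ j : ℕ, Q {y | (j : ℝ) < ‖y‖} ≤ ENNReal.ofReal (C * Real.exp (-j))) :
    ∫⁻ y, ENNReal.ofReal (Real.exp (‖y‖ / 2)) ∂Q ≤
      ENNReal.ofReal (1 + ∑' j : ℕ, C * Real.exp (1 / 2) * Real.exp (j * (-(1 / 2)))) := by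
  have hset : ∀ j : ℕ, MeasurableSet {y : E | (j : ℝ) < ‖y‖} := fun j =>
    measurableSet_lt measurable_const measurable_norm
  have hpt : ∀ y : E, ENNReal.ofReal (Real.exp (‖y‖ / 2)) ≤ 1 + ∑' j : ℕ,
      {y : E | (j : ℝ) < ‖y‖}.indicator
        (fun _ => ENNReal.ofReal (Real.exp ((j + 1) / 2))) y := by
    intro y
    rcases (norm_nonneg y).eq_or_lt with h0 | h0
    · rw [← h0]; simp
    · have hpos : 0 < ⌈‖y‖⌉₊ := Nat.ceil_pos.2 h0
      obtain ⟨j, hj⟩ : ∃ j, ⌈‖y‖⌉₊ = j + 1 := ⟨⌈‖y‖⌉₊ - 1, by omega⟩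
      have h1 : (j : ℝ) < ‖y‖ := Nat.lt_ceil.1 (by omega)
      have h2 : ‖y‖ ≤ j + 1 := by
        have := Nat.le_ceil ‖y‖
        rw [hj] at this
        exact_mod_cast this
      refine le_trans ?_ le_add_self
      refine le_trans ?_ (ENNReal.le_tsum j)
      rw [indicator_of_mem (by exact h1)]
      exact ENNReal.ofReal_le_ofReal (Real.exp_le_exp.2 (by linarith))
  have hsm : Summable fun j : ℕ => C * Real.exp (1 / 2) * Real.exp (j * (-(1 / 2))) :=
    (Real.summable_exp_nat_mul_iff.2 (by norm_num)).mul_left _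
  have hnn : ∀ j : ℕ, 0 ≤ C * Real.exp (1 / 2) * Real.exp (j * (-(1 / 2))) := fun j => by positivity
  calc ∫⁻ y, ENNReal.ofReal (Real.exp (‖y‖ / 2)) ∂Q
      ≤ ∫⁻ y, (1 + ∑' j : ℕ, {y : E | (j : ℝ) < ‖y‖}.indicator
        (fun _ => ENNReal.ofReal (Real.exp ((j + 1) / 2))) y) ∂Q := lintegral_mono hpt
    _ = 1 + ∑' j : ℕ, ENNReal.ofReal (Real.exp ((j + 1) / 2)) * Q {y : E | (j : ℝ) < ‖y‖} := by
        rw [lintegral_add_left measurable_const, lintegral_tsum fun j =>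
          (measurable_const.indicator (hset j)).aemeasurable]
        simp [lintegral_indicator_const (hset _)]
    _ ≤ 1 + ∑' j : ℕ, ENNReal.ofReal (C * Real.exp (1 / 2) * Real.exp (j * (-(1 / 2)))) := by
        refine add_le_add_right (ENNReal.tsum_le_tsum fun j => ?_) _
        refine (mul_le_mul_right (h j) _).trans (le_of_eq ?_)
        rw [← ENNReal.ofReal_mul (Real.exp_pos _).le, mul_left_comm, ← Real.exp_add, mul_assoc,
          ← Real.exp_add]
        congr 3
        ring
    _ = _ := by
        rw [ENNReal.ofReal_add zero_le_one (tsum_nonneg hnn), ENNReal.ofReal_one,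
          ENNReal.ofReal_tsum_of_nonneg hnn hsm]

theorem measure_norm_gt_le {Q : Measure E} {M R : ℝ} (hR : 0 ≤ R)
    (h : ∫⁻ y, ENNReal.ofReal (Real.exp (‖y‖ / 2)) ∂Q ≤ ENNReal.ofReal M) :
    Q {y | R < ‖y‖} ≤ ENNReal.ofReal (Real.exp (-R / 4) * M) := by
  have hset : MeasurableSet {y : E | R < ‖y‖} :=
    measurableSet_lt measurable_const measurable_norm
  rw [← lintegral_indicator_one hset]
  calc ∫⁻ y, {y : E | R < ‖y‖}.indicator 1 y ∂Q
      ≤ ∫⁻ y, ENNReal.ofReal (Real.exp (-R / 4)) * ENNReal.ofReal (Real.exp (‖y‖ / 2)) ∂Q := by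
        refine lintegral_mono fun y => ?_
        by_cases hy : R < ‖y‖
        · rw [indicator_of_mem (by exact hy), Pi.one_apply, ← ENNReal.ofReal_mul (Real.exp_pos _).le,
            ← Real.exp_add, ENNReal.one_le_ofReal, Real.one_le_exp_iff]
          linarith
        · rw [indicator_of_notMem (by exact hy)]
          exact zero_le
    _ ≤ _ := by
        rw [lintegral_const_mul _ (by fun_prop), ENNReal.ofReal_mul (Real.exp_pos _).le]
        exact mul_le_mul_right h _

/-- The factor `‖y‖` is absorbed by `‖y‖ ≤ 4 exp (‖y‖ / 4)`, and for `‖y‖ > R` one has `‖y‖ / 4 ≤ -R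
/ 4 + ‖y‖ / 2`. -/
theorem lintegral_norm_indicator_le {Q : Measure E} {M R : ℝ}
    (h : ∫⁻ y, ENNReal.ofReal (Real.exp (‖y‖ / 2)) ∂Q ≤ ENNReal.ofReal M) :
    ∫⁻ y, {y : E | R < ‖y‖}.indicator (fun y => ENNReal.ofReal ‖y‖) y ∂Q ≤
      ENNReal.ofReal (4 * Real.exp (-R / 4) * M) := by
  calc ∫⁻ y, {y : E | R < ‖y‖}.indicator (fun y => ENNReal.ofReal ‖y‖) y ∂Q
      ≤ ∫⁻ y, ENNReal.ofReal (4 * Real.exp (-R / 4)) * ENNReal.ofReal (Real.exp (‖y‖ / 2)) ∂Q := by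
        refine lintegral_mono fun y => ?_
        by_cases hy : R < ‖y‖
        · rw [indicator_of_mem (by exact hy), ← ENNReal.ofReal_mul (by positivity)]
          refine ENNReal.ofReal_le_ofReal ?_
          rw [mul_assoc, ← Real.exp_add]
          have h1 := Real.add_one_le_exp (‖y‖ / 4)
          have h2 : Real.exp (‖y‖ / 4) ≤ Real.exp (-R / 4 + ‖y‖ / 2) :=
            Real.exp_le_exp.2 (by linarith)
          linarith
        · rw [indicator_of_notMem (by exact hy)]
          exact zero_le
    _ ≤ _ := by
        rw [lintegral_const_mul _ (by fun_prop),
          ENNReal.ofReal_mul (p := 4 * Real.exp (-R / 4)) (by positivity)]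
        exact mul_le_mul_right h _

/-- On a compact set, the subgaussian conditional distributions have a common exponential
moment. -/
theorem exists_lintegral_exp_norm_le {G : Type*} [NormedAddCommGroup G] [MeasurableSpace G]
    {Γ : Set G} {κ : Kernel G E} [IsMarkovKernel κ] (hΓ : IsCompact Γ)
    (hsub : ConditionallySubgaussian Γ κ) (hlip : WassersteinLipschitz Γ κ) :
    ∃ M : ℝ, 0 < M ∧ ∀ x ∈ Γ,
      ∫⁻ y, ENNReal.ofReal (Real.exp (‖y‖ / 2)) ∂(κ x) ≤ ENNReal.ofReal M := by
  rcases Γ.eq_empty_or_nonempty with rfl | ⟨x₀, hx₀⟩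
  · exact ⟨1, one_pos, by simp⟩
  obtain ⟨σ, hσ, hsub⟩ := hsub
  obtain ⟨L, hL, hlip⟩ := hlip
  obtain ⟨D, hD⟩ := hΓ.isBounded.exists_norm_le
  -- A uniform bound on the conditional means: the mean at `x₀` plus `L` times a bound on the
  -- diameter of `Γ`.
  set B : ℝ := (∫ y, ‖y‖ ∂(κ x₀)) + L * (2 * D) with hB
  have hD₀ : 0 ≤ D := (norm_nonneg _).trans (hD x₀ hx₀)
  have hint₀ : 0 ≤ ∫ y, ‖y‖ ∂(κ x₀) := integral_nonneg fun y => norm_nonneg y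
  have hmean : ∀ x ∈ Γ, ∫ y, ‖y‖ ∂(κ x) ≤ B := by
    intro x hx
    have h := lintegral_norm_le_add_wasserstein1 (κ x₀) (κ x)
    rw [← ofReal_integral_eq_lintegral_ofReal (hsub x hx).1 (ae_of_all _ fun _ => norm_nonneg _),
      ← ofReal_integral_eq_lintegral_ofReal (hsub x₀ hx₀).1 (ae_of_all _ fun _ => norm_nonneg _)]
      at h
    have h2 := h.trans (add_le_add_right (hlip x₀ hx₀ x hx) _)
    rw [← ENNReal.ofReal_add hint₀ (by positivity), ENNReal.ofReal_le_ofReal_iff (by positivity)]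
      at h2
    refine h2.trans (add_le_add_right (mul_le_mul_of_nonneg_left ?_ hL.le) _)
    have := norm_sub_le x₀ x
    have := hD x hx
    have := hD x₀ hx₀
    linarith
  -- For `s = j - B > 0`, the square `(s - σ ^ 2) ^ 2 ≥ 0` gives `-s ^ 2 / (2 σ ^ 2) ≤ -s + σ ^ 2 /
  -- 2`. For `j ≤ B` the resulting bound exceeds one.
  set C : ℝ := Real.exp (B + σ ^ 2 / 2) with hC
  have hsum₀ : 0 ≤ ∑' j : ℕ, C * Real.exp (1 / 2) * Real.exp (j * (-(1 / 2))) :=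
    tsum_nonneg fun j => by positivity
  refine ⟨1 + ∑' j : ℕ, C * Real.exp (1 / 2) * Real.exp (j * (-(1 / 2))), by linarith,
    fun x hx => lintegral_exp_norm_le (κ x) (Real.exp_pos _).le fun j => ?_⟩
  rw [hC, ← Real.exp_add]
  rcases le_or_gt (j : ℝ) B with hj | hj
  · refine prob_le_one.trans ?_
    rw [ENNReal.one_le_ofReal, Real.one_le_exp_iff]
    have := sq_nonneg σ
    linarith
  · have h1 := (hsub x hx).2 (j - B) (by linarith)
    have h2 : (κ x) {y | (j : ℝ) < ‖y‖} ≤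
        (κ x) {y | ‖y‖ - ∫ y', ‖y'‖ ∂(κ x) > j - B} := by
      refine measure_mono fun y hy => ?_
      have := hmean x hx
      have hy' : (j : ℝ) < ‖y‖ := hy
      change (j : ℝ) - B < ‖y‖ - ∫ y', ‖y'‖ ∂(κ x)
      linarith
    refine h2.trans ?_
    rw [← ENNReal.ofReal_toReal (measure_ne_top (κ x) _)]
    refine ENNReal.ofReal_le_ofReal (h1.trans (Real.exp_le_exp.2 ?_))
    rw [div_le_iff₀ (by positivity)]
    nlinarith [sq_nonneg ((j - B) - σ ^ 2)]

end Tails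

/-! ### Comparing mixtures through their roundings. -/

section Discretization

theorem map_comp_eq_sum_dirac {E J : Type*} [MeasurableSpace E] [Fintype J] [MeasurableSpace J]
    [MeasurableSingletonClass J] (Q : Measure E) {cell : E → J} (hcell : Measurable cell)
    (c : J → E) : Q.map (c ∘ cell) = ∑ j, Q (cell ⁻¹' {j}) • Measure.dirac (c j) := by
  have hc : Measurable c := measurable_of_countable c
  rw [← Measure.map_map hc hcell, ← Measure.sum_smul_dirac (Q.map cell), Measure.sum_fintype,
    map_sum_smul _ _ hc]
  refine Finset.sum_congr rfl fun j _ => ?_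
  rw [Measure.map_dirac' hc, Measure.map_apply hcell (measurableSet_singleton j)]

variable {E ι : Type*} [MeasurableSpace E] [Fintype ι] {a : ι → ℝ} {Q : ι → Measure E}
  [∀ i, IsProbabilityMeasure (Q i)]

theorem sum_ofReal_eq_one (ha₀ : ∀ i, 0 ≤ a i) (ha : ∑ i, a i = 1) :
    ∑ i, ENNReal.ofReal (a i) = 1 := by
  rw [← ENNReal.ofReal_sum_of_nonneg fun i _ => ha₀ i, ha, ENNReal.ofReal_one]

theorem isProbabilityMeasure_mixture (ha₀ : ∀ i, 0 ≤ a i) (ha : ∑ i, a i = 1) :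
    IsProbabilityMeasure (∑ i, ENNReal.ofReal (a i) • Q i) := by
  constructor
  simp [Measure.finsetSum_apply, sum_ofReal_eq_one ha₀ ha]

theorem mixture_map_eq {J : Type*} [Fintype J] [MeasurableSpace J]
    [MeasurableSingletonClass J] (ha₀ : ∀ i, 0 ≤ a i) {cell : E → J} (hcell : Measurable cell)
    (c : J → E) :
    (∑ i, ENNReal.ofReal (a i) • Q i).map (c ∘ cell) =
      ∑ j, ENNReal.ofReal (∑ i, a i * (Q i).real (cell ⁻¹' {j})) • Measure.dirac (c j) := by
  rw [map_comp_eq_sum_dirac _ hcell]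
  refine Finset.sum_congr rfl fun j _ => ?_
  congr 1
  rw [Measure.finsetSum_apply, ENNReal.ofReal_sum_of_nonneg
    fun i _ => mul_nonneg (ha₀ i) measureReal_nonneg]
  refine Finset.sum_congr rfl fun i _ => ?_
  rw [Measure.smul_apply, smul_eq_mul, ENNReal.ofReal_mul (ha₀ i), ofReal_measureReal]

theorem wasserstein1_mixture_map_le {E : Type*} [NormedAddCommGroup E] [MeasurableSpace E]
    [BorelSpace E] [SecondCountableTopology E] {Q : ι → Measure E} (ha₀ : ∀ i, 0 ≤ a i)
    (ha : ∑ i, a i = 1) {T : E → E} (hT : Measurable T) {b : ℝ≥0∞}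
    (h : ∀ i, ∫⁻ y, ENNReal.ofReal ‖y - T y‖ ∂(Q i) ≤ b) :
    wasserstein1 (∑ i, ENNReal.ofReal (a i) • Q i)
      ((∑ i, ENNReal.ofReal (a i) • Q i).map T) ≤ b := by
  refine (wasserstein1_map_le _ hT).trans ?_
  rw [lintegral_finsetSum_measure]
  calc ∑ i, ∫⁻ y, ENNReal.ofReal ‖y - T y‖ ∂(ENNReal.ofReal (a i) • Q i)
      ≤ ∑ i, ENNReal.ofReal (a i) * b := by
        refine Finset.sum_le_sum fun i _ => ?_
        rw [lintegral_smul_measure]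
        exact mul_le_mul_right (h i) _
    _ = b := by rw [← Finset.sum_mul, sum_ofReal_eq_one ha₀ ha, one_mul]

/-- Two mixtures with the same weights are close if they nearly agree on the unions of cells of a
grid of mesh `η`, up to the tails. -/
theorem wasserstein1_mixture_le_of_cells {r : ℝ≥0∞} [Fact (1 ≤ r)] {d : ℕ}
    {Q Q' : ι → Measure (Vec r d)} [∀ i, IsProbabilityMeasure (Q i)]
    [∀ i, IsProbabilityMeasure (Q' i)] (ha₀ : ∀ i, 0 ≤ a i) (ha : ∑ i, a i = 1)
    {J : Type*} [Fintype J] [MeasurableSpace J] [MeasurableSingletonClass J]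
    {c : J → Vec r d} {cell : Vec r d → J} (hcell : Measurable cell) {R η τ t : ℝ}
    (hη : 0 ≤ η) (hηR : η ≤ R) (hτ : 0 ≤ τ) (ht : 0 ≤ t)
    (hc : ∀ j, ‖c j‖ ≤ d * (R + η)) (hcc : ∀ y, ‖y‖ ≤ R → ‖y - c (cell y)‖ ≤ d * η)
    (hQ : ∀ i, ∫⁻ y, {y | R < ‖y‖}.indicator (fun y => ENNReal.ofReal ‖y‖) y ∂(Q i) ≤
      ENNReal.ofReal τ)
    (hQ' : ∀ i, ∫⁻ y, {y | R < ‖y‖}.indicator (fun y => ENNReal.ofReal ‖y‖) y ∂(Q' i) ≤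
      ENNReal.ofReal τ)
    (hdev : ∀ S : Finset J, ∑ i, a i * ((Q i).real (cell ⁻¹' S) - (Q' i).real (cell ⁻¹' S)) ≤ t) :
    wasserstein1 (∑ i, ENNReal.ofReal (a i) • Q i) (∑ i, ENNReal.ofReal (a i) • Q' i) ≤
      ENNReal.ofReal (2 * (d * η + (1 + 2 * d) * τ) + 4 * d * R * t) := by
  have hT : Measurable (c ∘ cell) := (measurable_of_countable c).comp hcell
  have hset : MeasurableSet {y : Vec r d | R < ‖y‖} :=
    measurableSet_lt measurable_const measurable_norm
  -- Rounding moves a point of the ball by at most `d η`. Outside the ball, `η ≤ R < ‖y‖` bounds the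
  -- displacement by `(1 + 2 d) ‖y‖`.
  have hcost : ∀ P : Measure (Vec r d), IsProbabilityMeasure P →
      ∫⁻ y, {y | R < ‖y‖}.indicator (fun y => ENNReal.ofReal ‖y‖) y ∂P ≤ ENNReal.ofReal τ →
      ∫⁻ y, ENNReal.ofReal ‖y - (c ∘ cell) y‖ ∂P ≤
        ENNReal.ofReal (d * η + (1 + 2 * d) * τ) := by
    intro P hP hPτ
    calc ∫⁻ y, ENNReal.ofReal ‖y - (c ∘ cell) y‖ ∂P
        ≤ ∫⁻ y, (ENNReal.ofReal (d * η) + ENNReal.ofReal (1 + 2 * d) *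
            {y | R < ‖y‖}.indicator (fun y => ENNReal.ofReal ‖y‖) y) ∂P := by
          refine lintegral_mono fun y => ?_
          rcases le_or_gt ‖y‖ R with hy | hy
          · exact (ENNReal.ofReal_le_ofReal (hcc y hy)).trans le_self_add
          · rw [indicator_of_mem (by exact hy), ← ENNReal.ofReal_mul (by positivity)]
            refine le_trans (ENNReal.ofReal_le_ofReal ?_) le_add_self
            have h1 := norm_sub_le y (c (cell y))
            have h2 := hc (cell y)
            have h3 : (d : ℝ) * (R + η) ≤ d * (2 * ‖y‖) :=
              mul_le_mul_of_nonneg_left (by linarith) (Nat.cast_nonneg _)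
            simp only [Function.comp_apply]
            linarith
      _ ≤ ENNReal.ofReal (d * η) + ENNReal.ofReal (1 + 2 * d) * ENNReal.ofReal τ := by
          rw [lintegral_add_left measurable_const, lintegral_const, measure_univ, mul_one,
            lintegral_const_mul _ (Measurable.indicator (by fun_prop) hset)]
          gcongr
      _ = _ := by
          rw [← ENNReal.ofReal_mul (by positivity),
            ← ENNReal.ofReal_add (by positivity) (by positivity)]
  have hreal : ∀ (P : ι → Measure (Vec r d)), (∀ i, IsProbabilityMeasure (P i)) →
      ∀ S : Finset J, ∑ j ∈ S, ∑ i, a i * (P i).real (cell ⁻¹' {j}) =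
        ∑ i, a i * (P i).real (cell ⁻¹' S) := by
    intro P hP S
    rw [Finset.sum_comm]
    refine Finset.sum_congr rfl fun i _ => ?_
    rw [← Finset.mul_sum, sum_measureReal_preimage_singleton S
      fun j _ => hcell (measurableSet_singleton j)]
  have hp := isProbabilityMeasure_mixture (Q := Q) ha₀ ha
  have hp' := isProbabilityMeasure_mixture (Q := Q') ha₀ ha
  have hpm := Measure.isProbabilityMeasure_map (μ := ∑ i, ENNReal.ofReal (a i) • Q i)
    hT.aemeasurable
  have hpm' := Measure.isProbabilityMeasure_map (μ := ∑ i, ENNReal.ofReal (a i) • Q' i)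
    hT.aemeasurable
  have h1 := wasserstein1_mixture_map_le (Q := Q) ha₀ ha hT
    fun i => hcost (Q i) inferInstance (hQ i)
  have h2 := (wasserstein1_comm_le _ _).trans (wasserstein1_mixture_map_le (Q := Q') ha₀ ha hT
    fun i => hcost (Q' i) inferInstance (hQ' i))
  -- Both rounded mixtures live on the same atoms, at mutual distance at most `4 d R`.
  have h3 : wasserstein1 ((∑ i, ENNReal.ofReal (a i) • Q i).map (c ∘ cell))
      ((∑ i, ENNReal.ofReal (a i) • Q' i).map (c ∘ cell)) ≤ ENNReal.ofReal (4 * d * R * t) := by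
    rw [mixture_map_eq ha₀ hcell, mixture_map_eq ha₀ hcell]
    refine wasserstein1_sum_dirac_le c (fun i j => ?_)
      (fun j => Finset.sum_nonneg fun i _ => mul_nonneg (ha₀ i) measureReal_nonneg)
      (fun j => Finset.sum_nonneg fun i _ => mul_nonneg (ha₀ i) measureReal_nonneg) ?_ ?_ ?_
    · have h4 := norm_sub_le (c i) (c j)
      have h5 : (d : ℝ) * (R + η) ≤ d * (2 * R) :=
        mul_le_mul_of_nonneg_left (by linarith) (Nat.cast_nonneg _)
      linarith [hc i, hc j]
    · rw [hreal Q inferInstance, hreal Q' inferInstance]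
      simp
    · have : 0 ≤ R := hη.trans hηR
      positivity
    · intro S
      rw [Finset.sum_sub_distrib, hreal Q inferInstance, hreal Q' inferInstance,
        ← Finset.sum_sub_distrib]
      simpa only [mul_sub] using hdev S
  have hR : 0 ≤ R := hη.trans hηR
  calc _ ≤ _ := wasserstein1_triangle _ ((∑ i, ENNReal.ofReal (a i) • Q i).map (c ∘ cell)) _
    _ ≤ ENNReal.ofReal (d * η + (1 + 2 * d) * τ) + (ENNReal.ofReal (4 * d * R * t) +
        ENNReal.ofReal (d * η + (1 + 2 * d) * τ)) := by
        refine add_le_add h1 ((wasserstein1_triangle _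
          ((∑ i, ENNReal.ofReal (a i) • Q' i).map (c ∘ cell)) _).trans (add_le_add h3 h2))
    _ = _ := by
        rw [← ENNReal.ofReal_add (by positivity) (by positivity),
          ← ENNReal.ofReal_add (by positivity) (by positivity)]
        congr 1
        ring

end Discretization

/-! ### Uniform deviation over unions of cells. -/

section Deviation

variable {X Y J : Type*} [MeasurableSpace X] [MeasurableSpace Y] [Fintype J] [MeasurableSpace J]
  [MeasurableSingletonClass J] {N : ℕ}

/-- The samples for which the weighted empirical frequency of some union of cells falls short of
its conditional expectation by `t`, although the weights are at most `b`. -/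
def deviationSet (κ : Kernel X Y) (v : (Fin N → X) → Fin N → ℝ) (cell : Y → J) (b t : ℝ) :
    Set (Fin N → X × Y) :=
  {z | ((∀ i, 0 ≤ v (fun j => (z j).1) i ∧ v (fun j => (z j).1) i ≤ b) ∧
      ∑ i, v (fun j => (z j).1) i = 1) ∧
    ∃ S : Finset J, t ≤ ∑ i, v (fun j => (z j).1) i *
      ((κ (z i).1).real (cell ⁻¹' S) - (cell ⁻¹' S).indicator 1 (z i).2)}

theorem measurableSet_deviationSet (κ : Kernel X Y) [IsMarkovKernel κ]
    {v : (Fin N → X) → Fin N → ℝ} (hv : ∀ i, Measurable fun g => v g i) {cell : Y → J}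
    (hcell : Measurable cell) (b t : ℝ) : MeasurableSet (deviationSet κ v cell b t) := by
  have hv' : ∀ i, Measurable fun z : Fin N → X × Y => v (fun j => (z j).1) i := fun i =>
    (hv i).comp (by fun_prop)
  have hS : ∀ S : Finset J, MeasurableSet (cell ⁻¹' (S : Set J)) := fun S =>
    hcell S.measurableSet
  unfold deviationSet
  simp only [ofPred_and, ofPred_exists, ofPred_forall]
  refine MeasurableSet.inter (MeasurableSet.inter (MeasurableSet.iInter fun i => ?_) ?_)
    (MeasurableSet.iUnion fun S => ?_)
  · exact (measurableSet_le measurable_const (hv' i)).inter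
      (measurableSet_le (hv' i) measurable_const)
  · exact measurableSet_eq_fun (Finset.measurable_sum _ fun i _ => hv' i) measurable_const
  · refine measurableSet_le measurable_const (Finset.measurable_sum _ fun i _ => ?_)
    refine (hv' i).mul (Measurable.sub ?_ ?_)
    · exact ((κ.measurable_coe (hS S)).comp (by fun_prop)).ennreal_toReal
    · exact (measurable_one.indicator (hS S)).comp (by fun_prop)

/-- Freezing the first components makes the weights constant and the second components independent,
so Hoeffding applies to each union of cells. The weight conditions depend only on what is frozen:
where they fail the slice is empty, so the bound is uniform and integrates. -/
theorem measure_deviationSet_le (μ : Measure (X × Y)) [IsProbabilityMeasure μ] (κ : Kernel X Y)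
    [IsMarkovKernel κ] (hκ : μ.IsCondKernel κ)
    {v : (Fin N → X) → Fin N → ℝ} (hv : ∀ i, Measurable fun g => v g i) {cell : Y → J}
    (hcell : Measurable cell) {b t : ℝ} (hb : 0 < b) (ht : 0 ≤ t) :
    (Measure.pi fun _ : Fin N => μ) (deviationSet κ v cell b t) ≤
      ENNReal.ofReal (2 ^ Fintype.card J * Real.exp (-(2 * t ^ 2 / b))) := by
  have hmeas := measurableSet_deviationSet κ hv hcell b t
  have hpair : Measurable fun (z : (Fin N → X) × (Fin N → Y)) (i : Fin N) => (z.1 i, z.2 i) := by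
    fun_prop
  have hpi : (Measure.pi fun _ : Fin N => μ) = ((Measure.pi fun _ : Fin N => μ.fst) ⊗ₘ
      piKernel (Fin N) κ).map fun z i => (z.1 i, z.2 i) := by
    rw [← pi_compProd, hκ.disintegrate]
  rw [hpi, Measure.map_apply hpair hmeas, Measure.compProd_apply (hpair hmeas)]
  refine (lintegral_mono (g := fun _ => ENNReal.ofReal
    (2 ^ Fintype.card J * Real.exp (-(2 * t ^ 2 / b)))) fun x => ?_).trans (by simp)
  dsimp only
  rw [piKernel_apply]
  by_cases hx : (∀ i, 0 ≤ v x i ∧ v x i ≤ b) ∧ ∑ i, v x i = 1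
  · have hsub : Prod.mk x ⁻¹' ((fun (z : (Fin N → X) × (Fin N → Y)) (i : Fin N) =>
        (z.1 i, z.2 i)) ⁻¹' deviationSet κ v cell b t) ⊆
        ⋃ S ∈ (Finset.univ : Finset (Finset J)), {y | t ≤ ∑ i, v x i *
          ((∫ z, (cell ⁻¹' S).indicator (1 : Y → ℝ) z ∂(κ (x i))) -
            (cell ⁻¹' (S : Set J)).indicator 1 (y i))} := by
      rintro y ⟨-, S, hS⟩
      simp only [Finset.mem_univ, iUnion_true, mem_iUnion]
      refine ⟨S, ?_⟩
      simp only [integral_indicator_one (hcell S.measurableSet)]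
      exact hS
    refine (measure_mono hsub).trans ((measure_biUnion_finset_le _ _).trans ?_)
    have hle : ∀ S ∈ (Finset.univ : Finset (Finset J)), (Measure.pi fun i => κ (x i))
        {y | t ≤ ∑ i, v x i * ((∫ z, (cell ⁻¹' S).indicator (1 : Y → ℝ) z ∂(κ (x i))) -
            (cell ⁻¹' (S : Set J)).indicator 1 (y i))} ≤
        ENNReal.ofReal (Real.exp (-(2 * t ^ 2 / b))) := by
      intro S _
      rw [← ofReal_measureReal]
      refine ENNReal.ofReal_le_ofReal ?_
      exact measure_weighted_sum_ge_le (fun i => κ (x i))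
        (measurable_one.indicator (hcell S.measurableSet))
        (fun y => indicator_nonneg (fun _ _ => zero_le_one) y)
        (fun y => indicator_le_self' (fun _ _ => zero_le_one) y) (fun i => (hx.1 i).1)
        (fun i => (hx.1 i).2) hx.2 hb ht
    refine (Finset.sum_le_card_nsmul _ _ _ hle).trans (le_of_eq ?_)
    rw [Finset.card_univ, Fintype.card_finset, nsmul_eq_mul, ENNReal.ofReal_mul (by positivity),
      ENNReal.ofReal_pow zero_le_two]
    simp
  · have hemp : Prod.mk x ⁻¹' ((fun (z : (Fin N → X) × (Fin N → Y)) (i : Fin N) =>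
        (z.1 i, z.2 i)) ⁻¹' deviationSet κ v cell b t) = ∅ := by
      ext y
      simp only [mem_empty_iff_false, iff_false]
      exact fun h => hx h.1
    rw [hemp, measure_empty]
    exact zero_le

end Deviation

/-! ### Growth comparisons and Borel-Cantelli. -/

section Asymptotics

theorem tendsto_natCast_rpow {β : ℝ} (hβ : 0 < β) :
    Tendsto (fun N : ℕ => (N : ℝ) ^ β) atTop atTop :=
  (tendsto_rpow_atTop hβ).comp tendsto_natCast_atTop_atTop

theorem eventually_exp_neg_le {c β : ℝ} (hc : 0 < c) (hβ : 0 < β) (k : ℝ) :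
    ∀ᶠ N : ℕ in atTop, Real.exp (-c * (N : ℝ) ^ β) ≤ (N : ℝ) ^ (-k) := by
  have h := (isLittleO_exp_neg_mul_rpow_atTop hc (-k / β)).comp_tendsto (tendsto_natCast_rpow hβ)
  filter_upwards [h.bound one_pos] with N hN
  simp only [Function.comp_apply, one_mul] at hN
  rw [Real.norm_of_nonneg (Real.exp_pos _).le, Real.norm_of_nonneg (by positivity),
    ← Real.rpow_mul (Nat.cast_nonneg _)] at hN
  rwa [mul_div_cancel₀ _ hβ.ne'] at hN

theorem eventually_mul_rpow_le {α β : ℝ} (h : α < β) (A : ℝ) {B : ℝ} (hB : 0 < B) :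
    ∀ᶠ N : ℕ in atTop, A * (N : ℝ) ^ α ≤ B * (N : ℝ) ^ β := by
  filter_upwards [(tendsto_natCast_rpow (sub_pos.2 h)).eventually_ge_atTop (A / B),
    eventually_gt_atTop 0] with N hN hN0
  have hN0' : (0 : ℝ) < N := Nat.cast_pos.2 hN0
  rw [div_le_iff₀ hB, Real.rpow_sub hN0', div_mul_eq_mul_div, le_div_iff₀ (by positivity)] at hN
  linarith

/-- Half of the `B` term absorbs the lower power and the other half gives decay. Here `A N ^ α` is
the entropy of the union bound and `B N ^ β` the Hoeffding exponent. -/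
theorem summable_exp_sub {α β : ℝ} (h : α < β) (hβ : 0 < β) (A : ℝ) {B : ℝ} (hB : 0 < B) :
    Summable fun N : ℕ => Real.exp (A * (N : ℝ) ^ α - B * (N : ℝ) ^ β) := by
  refine Summable.of_norm_bounded_eventually_nat (g := fun N : ℕ => (N : ℝ) ^ (-2 : ℝ))
    (Real.summable_nat_rpow.2 (by norm_num)) ?_
  filter_upwards [eventually_mul_rpow_le h A (half_pos hB),
    eventually_exp_neg_le (half_pos hB) hβ 2] with N h1 h2
  rw [Real.norm_of_nonneg (Real.exp_pos _).le]
  refine le_trans (Real.exp_le_exp.2 ?_) h2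
  linarith

theorem summable_mul_exp_neg {β : ℝ} (hβ : 0 < β) {B : ℝ} (hB : 0 < B) :
    Summable fun N : ℕ => (N : ℝ) * Real.exp (-B * (N : ℝ) ^ β) := by
  refine Summable.of_norm_bounded_eventually_nat (g := fun N : ℕ => (N : ℝ) ^ (-2 : ℝ))
    (Real.summable_nat_rpow.2 (by norm_num)) ?_
  filter_upwards [eventually_exp_neg_le hB hβ 3, eventually_gt_atTop 0] with N h1 h0
  have hN0' : (0 : ℝ) < N := Nat.cast_pos.2 h0
  rw [Real.norm_of_nonneg (by positivity)]
  refine (mul_le_mul_of_nonneg_left h1 hN0'.le).trans (le_of_eq ?_)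
  nth_rewrite 1 [← Real.rpow_one (N : ℝ)]
  rw [← Real.rpow_add hN0']
  norm_num

/-- The Borel-Cantelli lemma, with bounds that hold eventually. -/
theorem ae_eventually_notMem_of_le {Ω : Type*} [MeasurableSpace Ω] {P : Measure Ω}
    {s : ℕ → Set Ω} {f : ℕ → ℝ} (hf : Summable f)
    (h : ∀ᶠ N in atTop, P (s N) ≤ ENNReal.ofReal (f N)) :
    ∀ᵐ ω ∂P, ∀ᶠ N in atTop, ω ∉ s N := by
  obtain ⟨N₀, hN₀⟩ := eventually_atTop.1 h
  have h1 : ∀ᵐ ω ∂P, ∀ᶠ N in atTop, ω ∉ (if N₀ ≤ N then s N else ∅) := by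
    refine ae_eventually_notMem (ne_top_of_le_ne_top hf.tsum_ofReal_ne_top
      (ENNReal.tsum_le_tsum fun N => ?_))
    split_ifs with hN
    · exact hN₀ N hN
    · simp
  filter_upwards [h1] with ω hω
  filter_upwards [hω, eventually_ge_atTop N₀] with N hN hN'
  rwa [if_pos hN'] at hN

end Asymptotics

/-! ### Bias plus fluctuation, and the general convergence rate. -/

section Core

variable {r : ℝ≥0∞} [Fact (1 ≤ r)] {dγ dξ : ℕ}

/-- The slack `e` supplies the strict bounds needed to choose near-optimal couplings; it is later
set to the mesh of the grid. -/
theorem wasserstein1_mixture_le_of_lipschitz {G E ι : Type*} [NormedAddCommGroup G]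
    [MeasurableSpace G] [NormedAddCommGroup E] [MeasurableSpace E] [Fintype ι] {Γ : Set G}
    {κ : Kernel G E} {L : ℝ} (hL : 0 ≤ L)
    (hlip : ∀ x ∈ Γ, ∀ x' ∈ Γ, wasserstein1 (κ x) (κ x') ≤ ENNReal.ofReal (L * ‖x - x'‖))
    {x : G} (hx : x ∈ Γ) {g : ι → G} (hg : ∀ i, g i ∈ Γ) {a : ι → ℝ} (ha₀ : ∀ i, 0 ≤ a i)
    (ha : ∑ i, a i = 1) {e : ℝ} (he : 0 < e) :
    wasserstein1 (κ x) (∑ i, ENNReal.ofReal (a i) • κ (g i)) ≤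
      ENNReal.ofReal (L * ∑ i, a i * ‖g i - x‖ + e) := by
  have h : ∀ i, wasserstein1 (κ x) (κ (g i)) < ENNReal.ofReal (L * ‖g i - x‖ + e) := fun i => by
    refine (hlip x hx (g i) (hg i)).trans_lt ?_
    rw [norm_sub_rev, ENNReal.ofReal_lt_ofReal_iff (by positivity)]
    linarith
  refine (wasserstein1_mixture_le (sum_ofReal_eq_one ha₀ ha) h).trans (le_of_eq ?_)
  simp_rw [← ENNReal.ofReal_mul (ha₀ _)]
  rw [← ENNReal.ofReal_sum_of_nonneg fun i _ => mul_nonneg (ha₀ i) (by positivity)]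
  congr 1
  simp_rw [mul_add, Finset.sum_add_distrib, ← Finset.sum_mul, ha, one_mul, Finset.mul_sum]
  congr 1
  exact Finset.sum_congr rfl fun i _ => by ring

theorem ae_forall_fst_mem {X Y : Type*} [MeasurableSpace X] [MeasurableSpace Y]
    {μ : Measure (X × Y)} [IsProbabilityMeasure μ] {Γ : Set X} (hΓ : ∀ᵐ z ∂μ, z.1 ∈ Γ) :
    ∀ᵐ ω ∂(Measure.infinitePi fun _ : ℕ => μ), ∀ i, (ω i).1 ∈ Γ := by
  rw [ae_all_iff]
  intro i
  exact (measurePreserving_eval_infinitePi (fun _ : ℕ => μ) i).quasiMeasurePreserving.ae hΓ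

/-- Off this event the first `N` observations lie in the ball, so their point masses have no tail to
pay for. -/
theorem measure_exists_norm_gt_le {X E : Type*} [MeasurableSpace X] [NormedAddCommGroup E]
    [MeasurableSpace E] [BorelSpace E] {μ : Measure (X × E)} [IsProbabilityMeasure μ]
    {κ : Kernel X E} [IsMarkovKernel κ] (hκ : μ.IsCondKernel κ) {Γ : Set X}
    (hΓ : ∀ᵐ z ∂μ, z.1 ∈ Γ) (hΓm : MeasurableSet Γ) {M R : ℝ} (hR : 0 ≤ R)
    (hM : ∀ x ∈ Γ, ∫⁻ y, ENNReal.ofReal (Real.exp (‖y‖ / 2)) ∂(κ x) ≤ ENNReal.ofReal M) (N : ℕ) :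
    (Measure.infinitePi fun _ : ℕ => μ) {ω | ∃ i < N, R < ‖(ω i).2‖} ≤
      ENNReal.ofReal (N * (Real.exp (-R / 4) * M)) := by
  have hset : MeasurableSet {y : E | R < ‖y‖} :=
    measurableSet_lt measurable_const measurable_norm
  have h1 : μ {z | R < ‖z.2‖} ≤ ENNReal.ofReal (Real.exp (-R / 4) * M) := by
    have hs : MeasurableSet {z : X × E | R < ‖z.2‖} := measurable_snd hset
    rw [← hκ.disintegrate, Measure.compProd_apply hs]
    have hae : ∀ᵐ x ∂μ.fst, x ∈ Γ := (ae_map_iff measurable_fst.aemeasurable hΓm).2 hΓ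
    calc ∫⁻ x, κ x (Prod.mk x ⁻¹' {z : X × E | R < ‖z.2‖}) ∂μ.fst
        ≤ ∫⁻ _, ENNReal.ofReal (Real.exp (-R / 4) * M) ∂μ.fst := by
          refine lintegral_mono_ae ?_
          filter_upwards [hae] with x hx
          exact measure_norm_gt_le hR (hM x hx)
      _ = _ := by simp
  have h2 : {ω : ℕ → X × E | ∃ i < N, R < ‖(ω i).2‖} ⊆
      ⋃ i ∈ Finset.range N, (fun ω : ℕ → X × E => ω i) ⁻¹' {z | R < ‖z.2‖} := by
    rintro ω ⟨i, hi, hω⟩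
    simp only [mem_iUnion]
    exact ⟨i, Finset.mem_range.2 hi, hω⟩
  refine (measure_mono h2).trans ((measure_biUnion_finset_le _ _).trans ?_)
  have h3 : ∀ i ∈ Finset.range N, (Measure.infinitePi fun _ : ℕ => μ)
      ((fun ω : ℕ → X × E => ω i) ⁻¹' {z | R < ‖z.2‖}) ≤
      ENNReal.ofReal (Real.exp (-R / 4) * M) := fun i _ => by
    refine le_trans (le_of_eq ?_) h1
    exact (measurePreserving_eval_infinitePi (fun _ : ℕ => μ) i).measure_preimage
      (measurable_snd hset).nullMeasurableSet
  refine (Finset.sum_le_card_nsmul _ _ _ h3).trans (le_of_eq ?_)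
  rw [Finset.card_range, nsmul_eq_mul, ENNReal.ofReal_mul (Nat.cast_nonneg _),
    ENNReal.ofReal_natCast]

/-- At a fixed sample size, outside an event of small probability the empirical conditional
measure is close to the conditional distribution whenever the weights are well behaved. -/
theorem exists_bad_event {Γ : Set (Vec r dγ)} {μ : Measure (Vec r dγ × Vec r dξ)}
    [IsProbabilityMeasure μ] (hΓ : ∀ᵐ z ∂μ, z.1 ∈ Γ) (hΓm : MeasurableSet Γ)
    {κ : Kernel (Vec r dγ) (Vec r dξ)} [IsMarkovKernel κ] (hκ : μ.IsCondKernel κ)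
    {w : WeightFamily (Vec r dγ)} {L M : ℝ} (hL : 0 ≤ L) (hM₀ : 0 ≤ M)
    (hlip : ∀ x ∈ Γ, ∀ x' ∈ Γ, wasserstein1 (κ x) (κ x') ≤ ENNReal.ofReal (L * ‖x - x'‖))
    (hM : ∀ x ∈ Γ, ∫⁻ y, ENNReal.ofReal (Real.exp (‖y‖ / 2)) ∂(κ x) ≤ ENNReal.ofReal M)
    {x : Vec r dγ} (hx : x ∈ Γ) {N : ℕ} (hw : ∀ i, Measurable fun g => w N g x i)
    {R η t b : ℝ} (hη : 0 < η) (hηR : η ≤ R) (ht : 0 ≤ t) (hb : 0 < b) :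
    ∃ bad : Set (ℕ → Vec r dγ × Vec r dξ),
      (Measure.infinitePi fun _ : ℕ => μ) bad ≤ ENNReal.ofReal
        (Real.exp ((2 * (R / η) + 3) ^ dξ - 2 * t ^ 2 / b) + N * (Real.exp (-R / 4) * M)) ∧
      ∀ ω ∉ bad, (∀ i, (ω i).1 ∈ Γ) →
        (∀ i, 0 ≤ w N (fun j => (ω j).1) x i ∧ w N (fun j => (ω j).1) x i ≤ b) →
        ∑ i, w N (fun j => (ω j).1) x i = 1 →
        wasserstein1 (κ x) (empiricalConditional w N x ω) ≤ ENNReal.ofReal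
          (L * (∑ i, w N (fun j => (ω j).1) x i * ‖(ω i).1 - x‖) + η +
            (2 * (dξ * η + (1 + 2 * dξ) * (4 * Real.exp (-R / 4) * M)) + 4 * dξ * R * t)) := by
  have hR : 0 ≤ R := hη.le.trans hηR
  obtain ⟨m, c, cell, hcell, hm, hc, hcc⟩ := exists_grid (r := r) (d := dξ) hη hR
  set v : (Fin N → Vec r dγ) → Fin N → ℝ := fun g i => w N g x i with hv
  set F : (ℕ → Vec r dγ × Vec r dξ) → Fin N → Vec r dγ × Vec r dξ := fun ω i => ω i with hF
  have hFm : Measurable F := by fun_prop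
  refine ⟨F ⁻¹' deviationSet κ v cell b t ∪ {ω | ∃ i < N, R < ‖(ω i).2‖}, ?_, ?_⟩
  · refine (measure_union_le _ _).trans ?_
    rw [ENNReal.ofReal_add (Real.exp_pos _).le (by positivity)]
    refine add_le_add ?_ (measure_exists_norm_gt_le hκ hΓ hΓm hR hM N)
    rw [← Measure.map_apply hFm (measurableSet_deviationSet κ hw hcell b t),
      infinitePi_map_fin]
    refine (measure_deviationSet_le μ κ hκ hw hcell hb ht).trans (ENNReal.ofReal_le_ofReal ?_)
    rw [sub_eq_add_neg, Real.exp_add]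
    refine mul_le_mul_of_nonneg_right ?_ (Real.exp_pos _).le
    have h2 : (2 : ℝ) ≤ Real.exp 1 := by
      have := Real.add_one_le_exp (1 : ℝ)
      linarith
    calc (2 : ℝ) ^ Fintype.card (Fin dξ → Fin m) ≤ Real.exp 1 ^ Fintype.card (Fin dξ → Fin m) :=
          pow_le_pow_left₀ zero_le_two h2 _
      _ = Real.exp ((m : ℝ) ^ dξ) := by
          rw [← Real.exp_nat_mul]
          simp
      _ ≤ _ := Real.exp_le_exp.2 (pow_le_pow_left₀ (Nat.cast_nonneg _) hm _)
  · intro ω hω hωΓ hω₀ hω₁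
    simp only [mem_union, not_or] at hω
    obtain ⟨hdev, hnorm⟩ := hω
    have hnorm' : ∀ i < N, ‖(ω i).2‖ ≤ R := by
      intro i hi
      by_contra hcon
      exact hnorm ⟨i, hi, not_le.1 hcon⟩
    have hset : MeasurableSet {y : Vec r dξ | R < ‖y‖} :=
      measurableSet_lt measurable_const measurable_norm
    -- `h1` is the bias and `h2` the fluctuation, joined at the mixture of the true conditional laws
    -- at the observed points.
    have h1 := wasserstein1_mixture_le_of_lipschitz hL hlip hx
      (g := fun i : Fin N => (ω i).1) (fun i => hωΓ i) (fun i => (hω₀ i).1) hω₁ hη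
    have h2 := wasserstein1_mixture_le_of_cells (Q := fun i : Fin N => κ (ω i).1)
      (Q' := fun i : Fin N => Measure.dirac (ω i).2) (fun i => (hω₀ i).1) hω₁ hcell hη.le hηR
      (τ := 4 * Real.exp (-R / 4) * M) (by positivity) ht hc hcc
      (fun i => lintegral_norm_indicator_le (hM _ (hωΓ i)))
      (fun i => by
        rw [lintegral_dirac' _ (Measurable.indicator (by fun_prop) hset),
          indicator_of_notMem (s := {y : Vec r dξ | R < ‖y‖}) (not_lt.2 (hnorm' i i.2))]
        exact zero_le)
      (fun S => by
        by_contra hcon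
        refine hdev ⟨⟨hω₀, hω₁⟩, S, ?_⟩
        refine (not_le.1 hcon).le.trans (le_of_eq (Finset.sum_congr rfl fun i _ => ?_))
        congr 2
        rw [← integral_indicator_one (hcell S.measurableSet), integral_dirac' _ _
          (measurable_one.indicator (hcell S.measurableSet)).stronglyMeasurable])
    have hp := isProbabilityMeasure_mixture (Q := fun i : Fin N => κ (ω i).1)
      (fun i => (hω₀ i).1) hω₁
    refine (wasserstein1_triangle _ _ _).trans ((add_le_add h1 h2).trans (le_of_eq ?_))
    have hsum : 0 ≤ ∑ i, w N (fun j => (ω j).1) x i * ‖(ω i).1 - x‖ :=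
      Finset.sum_nonneg fun i _ => mul_nonneg (hω₀ i).1 (norm_nonneg _)
    rw [ENNReal.ofReal_add (p := L * _ + η) (by positivity) (by positivity)]

/-- If eventually the weights are a probability vector, are of order at most `N ^ (-s)`, and
concentrate near `x` at rate `N ^ (-b)`, then the empirical conditional measure converges faster
than `N ^ (-p)`. -/
theorem ae_eventually_wasserstein1_le {Γ : Set (Vec r dγ)}
    {μ : Measure (Vec r dγ × Vec r dξ)}
    [IsProbabilityMeasure μ] (hΓ : ∀ᵐ z ∂μ, z.1 ∈ Γ) (hΓc : IsCompact Γ)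
    {κ : Kernel (Vec r dγ) (Vec r dξ)} [IsMarkovKernel κ] (hκ : μ.IsCondKernel κ)
    {w : WeightFamily (Vec r dγ)} (hsub : ConditionallySubgaussian Γ κ)
    (hlip : WassersteinLipschitz Γ κ) {x : Vec r dγ} (hx : x ∈ Γ)
    (hw : ∀ᶠ N in atTop, ∀ i, Measurable fun g => w N g x i)
    {k p s b B C : ℝ} (hk : 0 < k) (hp : 0 < p) (hps : p * (dξ + 2) < s) (hpb : p < b)
    (hC : 0 < C)
    (hgood : ∀ᵐ ω ∂(Measure.infinitePi fun _ : ℕ => μ), ∀ᶠ N : ℕ in atTop,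
      (∀ i, 0 ≤ w N (fun j => (ω j).1) x i ∧ w N (fun j => (ω j).1) x i ≤ C * (N : ℝ) ^ (-s)) ∧
      ∑ i, w N (fun j => (ω j).1) x i = 1 ∧
      ∑ i, w N (fun j => (ω j).1) x i * ‖(ω i).1 - x‖ ≤ B * (N : ℝ) ^ (-b)) :
    ∀ᵐ ω ∂(Measure.infinitePi fun _ : ℕ => μ), ∀ᶠ N : ℕ in atTop,
      wasserstein1 (κ x) (empiricalConditional w N x ω) ≤ ENNReal.ofReal (k / (N : ℝ) ^ p) := by
  obtain ⟨M, hM₀, hM⟩ := exists_lintegral_exp_norm_le hΓc hsub hlip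
  obtain ⟨L, hL, hlip⟩ := hlip
  have hd : (0 : ℝ) < dξ + 2 := by positivity
  obtain ⟨u, hpu, hus⟩ : ∃ u, p < u ∧ u < s / (dξ + 2) := exists_between ((lt_div_iff₀ hd).2 hps)
  rw [lt_div_iff₀ hd] at hus
  -- Take `R = N ^ a`, `η = N ^ (-q)`, `t = N ^ (-u)` with `u = q + a`. Then `R / η = N ^ u`, and
  -- both `η` and `R t` equal `N ^ (-q)`, which is `o(N ^ (-p))`.
  obtain ⟨q, a, hpq, ha, hqa⟩ : ∃ q a : ℝ, p < q ∧ 0 < a ∧ q + a = u :=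
    ⟨(p + u) / 2, (u - p) / 2, by linarith, by linarith, by ring⟩
  have hu : 0 < u := hp.trans hpu
  have hbad : ∀ N : ℕ, ∃ bad : Set (ℕ → Vec r dγ × Vec r dξ), 1 ≤ N →
      (∀ i, Measurable fun g => w N g x i) →
      (Measure.infinitePi fun _ : ℕ => μ) bad ≤ ENNReal.ofReal
        (Real.exp (5 ^ dξ * (N : ℝ) ^ (u * dξ) - 2 / C * (N : ℝ) ^ (s - 2 * u)) +
          M * (N * Real.exp (-(1 / 4) * (N : ℝ) ^ a))) ∧
      ∀ ω ∉ bad, (∀ i, (ω i).1 ∈ Γ) →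
        (∀ i, 0 ≤ w N (fun j => (ω j).1) x i ∧
          w N (fun j => (ω j).1) x i ≤ C * (N : ℝ) ^ (-s)) →
        ∑ i, w N (fun j => (ω j).1) x i = 1 →
        wasserstein1 (κ x) (empiricalConditional w N x ω) ≤ ENNReal.ofReal
          (L * (∑ i, w N (fun j => (ω j).1) x i * ‖(ω i).1 - x‖) + (1 + 6 * dξ) * (N : ℝ) ^ (-q) +
            8 * (1 + 2 * dξ) * M * Real.exp (-(1 / 4) * (N : ℝ) ^ a)) := by
    intro N
    by_cases hN : 1 ≤ N ∧ ∀ i, Measurable fun g => w N g x i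
    swap
    · exact ⟨∅, fun h1 h2 => absurd ⟨h1, h2⟩ hN⟩
    have hN1 : (1 : ℝ) ≤ N := by exact_mod_cast hN.1
    have hN0 : (0 : ℝ) < N := by linarith
    have hηR : (N : ℝ) ^ (-q) ≤ (N : ℝ) ^ a :=
      Real.rpow_le_rpow_of_exponent_le hN1 (by linarith)
    obtain ⟨bad, h1, h2⟩ := exists_bad_event hΓ hΓc.measurableSet hκ hL.le hM₀.le hlip hM hx hN.2
      (R := (N : ℝ) ^ a) (η := (N : ℝ) ^ (-q)) (t := (N : ℝ) ^ (-u)) (b := C * (N : ℝ) ^ (-s))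
      (by positivity) hηR (by positivity) (by positivity)
    have hexp : -(N : ℝ) ^ a / 4 = -(1 / 4) * (N : ℝ) ^ a := by ring
    rw [hexp] at h1 h2
    refine ⟨bad, fun _ _ => ⟨h1.trans (ENNReal.ofReal_le_ofReal ?_), fun ω hω hωΓ hω₀ hω₁ =>
      (h2 ω hω hωΓ hω₀ hω₁).trans (ENNReal.ofReal_le_ofReal (le_of_eq ?_))⟩⟩
    · refine add_le_add (Real.exp_le_exp.2 (sub_le_sub ?_ (le_of_eq ?_))) (le_of_eq (by ring))
      · have h3 : (N : ℝ) ^ a / (N : ℝ) ^ (-q) = (N : ℝ) ^ u := by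
          rw [← Real.rpow_sub hN0]
          congr 1
          linarith
        -- This turns `2 N ^ u + 3` into `5 N ^ u`, the source of the constant `5 ^ dξ`.
        have h4 : 1 ≤ (N : ℝ) ^ u := Real.one_le_rpow hN1 hu.le
        rw [h3, Real.rpow_mul hN0.le, Real.rpow_natCast, ← mul_pow]
        exact pow_le_pow_left₀ (by positivity) (by linarith) _
      · rw [Real.rpow_sub hN0, Real.rpow_neg hN0.le, Real.rpow_neg hN0.le, two_mul u,
          Real.rpow_add hN0]
        field_simp
    · have h3 : (N : ℝ) ^ a * (N : ℝ) ^ (-u) = (N : ℝ) ^ (-q) := by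
        rw [← Real.rpow_add hN0]
        congr 1
        linarith
      rw [mul_assoc (4 * (dξ : ℝ)), h3]
      ring
  choose bad hbad using hbad
  have hlim : ∀ᶠ N : ℕ in atTop, L * (B * (N : ℝ) ^ (-b)) + (1 + 6 * dξ) * (N : ℝ) ^ (-q) +
      8 * (1 + 2 * dξ) * M * Real.exp (-(1 / 4) * (N : ℝ) ^ a) ≤ k / (N : ℝ) ^ p := by
    filter_upwards [eventually_mul_rpow_le (neg_lt_neg hpb) (L * B) (B := k / 3) (by positivity),
      eventually_mul_rpow_le (neg_lt_neg hpq) (1 + 6 * dξ) (B := k / 3) (by positivity),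
      eventually_mul_rpow_le (neg_lt_neg hpq) (8 * (1 + 2 * dξ) * M) (B := k / 3) (by positivity),
      eventually_exp_neg_le (c := 1 / 4) (by norm_num) ha q] with N h1 h2 h3 h4
    have h5 := mul_le_mul_of_nonneg_left h4 (a := 8 * (1 + 2 * (dξ : ℝ)) * M) (by positivity)
    rw [div_eq_mul_inv k, ← Real.rpow_neg (Nat.cast_nonneg _)]
    linarith
  have hsum : Summable fun N : ℕ =>
      Real.exp (5 ^ dξ * (N : ℝ) ^ (u * dξ) - 2 / C * (N : ℝ) ^ (s - 2 * u)) +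
        M * (N * Real.exp (-(1 / 4) * (N : ℝ) ^ a)) := by
    have h0 : 0 ≤ u * dξ := by positivity
    -- The Hoeffding exponent beats the number of cells because `u dξ < s - 2 u`, that is, `u (dξ +
    -- 2) < s`.
    exact (summable_exp_sub (by linarith) (by linarith) _ (by positivity)).add
      ((summable_mul_exp_neg ha (by norm_num)).mul_left M)
  have hBC := ae_eventually_notMem_of_le hsum (by
    filter_upwards [hw, eventually_ge_atTop 1] with N h1 h2
    exact (hbad N h2 h1).1)
  filter_upwards [hBC, ae_forall_fst_mem hΓ, hgood] with ω h1 h2 h3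
  filter_upwards [h1, h3, hlim, hw, eventually_ge_atTop 1] with N h4 h5 h6 h7 h8
  refine ((hbad N h8 h7).2 ω h4 h2 h5.1 h5.2.1).trans (ENNReal.ofReal_le_ofReal ?_)
  have := mul_le_mul_of_nonneg_left h5.2.2 hL.le
  linarith

end Core

/-! ### Number of samples in shrinking balls. -/

section Counting

open scoped Classical in
/-- Almost surely, a ball around a point of `Γ` whose radius shrinks slowly enough eventually
contains at least half of the expected number of samples. -/
theorem ae_eventually_le_card_ball {G E : Type*} [NormedAddCommGroup G] [MeasurableSpace G]
    [BorelSpace G] [SecondCountableTopology G] [MeasurableSpace E] {μ : Measure (G × E)}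
    [IsProbabilityMeasure μ] {d : ℕ} {x : G} {g c a : ℝ} (hg : 0 < g) (hc : 0 < c) (ha : 0 < a)
    (had : 2 * (a * d) < 1)
    (hball : ∀ e : ℝ, 0 < e → e ≤ 1 → g * e ^ d ≤ μ.real {z | ‖z.1 - x‖ ≤ e}) :
    ∀ᵐ ω ∂(Measure.infinitePi fun _ : ℕ => μ), ∀ᶠ N : ℕ in atTop,
      g / 2 * c ^ d * (N : ℝ) ^ (1 - a * d) ≤
        ((Finset.univ.filter fun i : Fin N => ‖(ω i).1 - x‖ ≤ c * (N : ℝ) ^ (-a)).card : ℝ) := by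
  -- The exponent is Hoeffding's with weights `1 / N` and deviation half of `g e ^ d`, where `e = c
  -- N ^ (-a)`. It grows because `2 a d < 1`; the zero term only fits the shape of
  -- `summable_exp_sub`.
  have hsum : Summable fun N : ℕ => Real.exp (0 * (N : ℝ) ^ (-a) -
      g ^ 2 * (c ^ d) ^ 2 / 2 * (N : ℝ) ^ (1 - 2 * (a * d))) :=
    summable_exp_sub (by linarith) (by linarith) _ (by positivity)
  have hone : ∀ᶠ N : ℕ in atTop, c * (N : ℝ) ^ (-a) ≤ 1 := by
    filter_upwards [eventually_mul_rpow_le (neg_lt_zero.2 ha) c one_pos] with N hN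
    simpa using hN
  have hBC := ae_eventually_notMem_of_le (P := Measure.infinitePi fun _ : ℕ => μ)
    (s := fun N => {ω | ((Finset.univ.filter fun i : Fin N =>
      ‖(ω i).1 - x‖ ≤ c * (N : ℝ) ^ (-a)).card : ℝ) < g / 2 * c ^ d * (N : ℝ) ^ (1 - a * d)})
    hsum (by
      filter_upwards [hone, eventually_ge_atTop 1] with N he1 hN
      have hN0 : (0 : ℝ) < N := by exact_mod_cast hN
      set e : ℝ := c * (N : ℝ) ^ (-a) with he
      have he0 : 0 < e := by positivity
      set S : Set (G × E) := {z | ‖z.1 - x‖ ≤ e} with hS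
      have hSm : MeasurableSet S := measurableSet_le (by fun_prop) measurable_const
      have hed : e ^ d = c ^ d * (N : ℝ) ^ (-(a * d)) := by
        rw [he, mul_pow, ← Real.rpow_natCast ((N : ℝ) ^ (-a)), ← Real.rpow_mul hN0.le, neg_mul]
      have hH := measure_weighted_sum_ge_le (fun _ : Fin N => μ) (f := S.indicator 1)
        (measurable_one.indicator hSm) (fun y => indicator_nonneg (fun _ _ => zero_le_one) y)
        (fun y => indicator_le_self' (fun _ _ => zero_le_one) y) (a := fun _ => 1 / (N : ℝ))
        (b := 1 / (N : ℝ)) (t := g * e ^ d / 2) (fun _ => by positivity) (fun _ => le_rfl)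
        (by simp [hN0.ne']) (by positivity) (by positivity)
      simp only [integral_indicator_one hSm] at hH
      have hFm : Measurable fun (ω : ℕ → G × E) (i : Fin N) => ω i := by fun_prop
      have hsub : {ω : ℕ → G × E | ((Finset.univ.filter fun i : Fin N =>
          ‖(ω i).1 - x‖ ≤ e).card : ℝ) < g / 2 * c ^ d * (N : ℝ) ^ (1 - a * d)} ⊆
          (fun (ω : ℕ → G × E) (i : Fin N) => ω i) ⁻¹' {y | g * e ^ d / 2 ≤
            ∑ i : Fin N, 1 / (N : ℝ) * (μ.real S - S.indicator 1 (y i))} := by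
        intro ω hω
        change g * e ^ d / 2 ≤
          ∑ i : Fin N, 1 / (N : ℝ) * (μ.real S - S.indicator 1 (ω i))
        have hω' : ((Finset.univ.filter fun i : Fin N => ‖(ω i).1 - x‖ ≤ e).card : ℝ) <
          g / 2 * c ^ d * (N : ℝ) ^ (1 - a * d) := hω
        have hcard : ∑ i : Fin N, S.indicator (1 : G × E → ℝ) (ω i) =
            ((Finset.univ.filter fun i : Fin N => ‖(ω i).1 - x‖ ≤ e).card : ℝ) := by
          rw [Finset.card_filter]
          push_cast
          exact Finset.sum_congr rfl fun i _ => by simp [indicator_apply, hS]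
        rw [← Finset.mul_sum, Finset.sum_sub_distrib, hcard]
        simp only [Finset.sum_const, Finset.card_univ, Fintype.card_fin, nsmul_eq_mul]
        have hb := hball e he0 he1
        rw [sub_eq_add_neg, Real.rpow_add hN0, Real.rpow_one] at hω'
        rw [one_div, inv_mul_eq_div, le_div_iff₀ hN0]
        have h1 := mul_le_mul_of_nonneg_right hb hN0.le
        rw [hed] at h1 ⊢
        rw [← hS] at h1
        nlinarith
      refine (measure_mono hsub).trans ((Measure.le_map_apply hFm.aemeasurable _).trans ?_)
      rw [infinitePi_map_fin, ← ofReal_measureReal]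
      refine ENNReal.ofReal_le_ofReal (hH.trans (Real.exp_le_exp.2 (le_of_eq ?_)))
      rw [hed, zero_mul, zero_sub, sub_eq_add_neg, Real.rpow_add hN0, Real.rpow_one, two_mul (a * d),
        neg_add, Real.rpow_add hN0]
      field_simp)
  filter_upwards [hBC] with ω hω
  filter_upwards [hω] with N hN
  exact not_lt.1 hN

end Counting

/-! ### Nearest neighbor weights. -/

section NearestNeighbor

variable {G : Type*} [NormedAddCommGroup G] {N : ℕ}

/-- Thanks to the tie-breaking rule, `Closer` is a strict linear order on the samples; this and the
next two lemmas record it. -/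
theorem closer_trans {g : Fin N → G} {x : G} {i j l : Fin N} (h₁ : Closer g x i j)
    (h₂ : Closer g x j l) : Closer g x i l := by
  rcases h₁ with h₁ | ⟨h₁, h₁'⟩ <;> rcases h₂ with h₂ | ⟨h₂, h₂'⟩
  · exact Or.inl (h₁.trans h₂)
  · exact Or.inl (h₂ ▸ h₁)
  · exact Or.inl (h₁ ▸ h₂)
  · exact Or.inr ⟨h₁.trans h₂, h₁'.trans h₂'⟩

theorem not_closer_self (g : Fin N → G) (x : G) (i : Fin N) : ¬ Closer g x i i := by
  simp [Closer]

theorem closer_or_closer (g : Fin N → G) (x : G) {i j : Fin N} (h : i ≠ j) :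
    Closer g x i j ∨ Closer g x j i := by
  unfold Closer
  rcases lt_trichotomy ‖g i - x‖ ‖g j - x‖ with h₁ | h₁ | h₁
  · exact Or.inl (Or.inl h₁)
  · rcases h.lt_or_gt with h₂ | h₂
    · exact Or.inl (Or.inr ⟨h₁, h₂⟩)
    · exact Or.inr (Or.inr ⟨h₁.symm, h₂⟩)
  · exact Or.inr (Or.inl h₁)

open scoped Classical in
/-- There are exactly `k` nearest neighbors when `k ≤ N`. -/
theorem card_isNearestNeighbor {k : ℕ} (hk : k ≤ N) (g : Fin N → G) (x : G) :
    (Finset.univ.filter fun i => IsNearestNeighbor k g x i).card = k := by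
  -- The rank is strictly monotone along `Closer`, hence a bijection onto `0, …, N - 1`; the nearest
  -- neighbors are the samples of rank below `k`.
  set rank : Fin N → ℕ := fun i => {j : Fin N | j ≠ i ∧ Closer g x j i}.ncard with hrank
  have hlt : ∀ i, rank i < N := by
    intro i
    have h : {j : Fin N | j ≠ i ∧ Closer g x j i} ⊂ univ :=
      ssubset_univ_iff.2 fun h => (h ▸ mem_univ i : i ∈ {j | j ≠ i ∧ Closer g x j i}).1 rfl
    have := ncard_lt_ncard h
    simpa [ncard_univ] using this
  have hmono : ∀ i j, Closer g x i j → rank i < rank j := by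
    intro i j hij
    have hne : i ≠ j := fun h => not_closer_self g x j (h ▸ hij)
    refine ncard_lt_ncard ⟨fun l hl => ⟨?_, closer_trans hl.2 hij⟩, fun h => ?_⟩
    · rintro rfl
      exact not_closer_self g x l (closer_trans hl.2 hij)
    · exact (h ⟨hne, hij⟩ : i ≠ i ∧ Closer g x i i).1 rfl
  have hinj : Function.Injective fun i => (⟨rank i, hlt i⟩ : Fin N) := by
    intro i j hij
    by_contra hne
    have hij' : rank i = rank j := congrArg Fin.val hij
    rcases closer_or_closer g x hne with h | h
    · exact (hmono _ _ h).ne hij'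
    · exact (hmono _ _ h).ne' hij'
  have hbij : Function.Bijective fun i => (⟨rank i, hlt i⟩ : Fin N) :=
    Finite.injective_iff_bijective.1 hinj
  calc (Finset.univ.filter fun i => IsNearestNeighbor k g x i).card
      = (Finset.univ.filter fun l : Fin N => (l : ℕ) < k).card := by
        refine Finset.card_bijective _ hbij fun i => ?_
        simp only [Finset.mem_filter_univ]
        exact Iff.rfl
    _ = k := by
        rw [Fin.card_filter_val_lt]
        exact min_eq_right hk

theorem sum_knnWeight {k : ℕ} (hk₀ : 0 < k) (hk : k ≤ N) (g : Fin N → G) (x : G) :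
    ∑ i, knnWeight k g x i = 1 := by
  classical
  have hk' : (k : ℝ) ≠ 0 := by positivity
  unfold knnWeight
  rw [← Finset.sum_filter, Finset.sum_const, card_isNearestNeighbor hk, nsmul_eq_mul,
    mul_one_div_cancel hk']

theorem knnWeight_nonneg (k : ℕ) (g : Fin N → G) (x : G) (i : Fin N) : 0 ≤ knnWeight k g x i := by
  unfold knnWeight
  split_ifs <;> positivity

theorem knnWeight_le (k : ℕ) (g : Fin N → G) (x : G) (i : Fin N) :
    knnWeight k g x i ≤ 1 / k := by
  unfold knnWeight
  split_ifs
  · exact le_rfl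
  · positivity

open scoped Classical in
-- A sample outside the ball has all the ball's samples, at least `k` of them, strictly closer than
-- itself.
theorem norm_sub_le_of_isNearestNeighbor {k : ℕ} {g : Fin N → G} {x : G} {e : ℝ}
    (hk : k ≤ (Finset.univ.filter fun i => ‖g i - x‖ ≤ e).card) {i : Fin N}
    (hi : IsNearestNeighbor k g x i) : ‖g i - x‖ ≤ e := by
  by_contra hcon
  rw [not_le] at hcon
  refine absurd hi (not_lt.2 (hk.trans ?_))
  rw [← ncard_coe_finset]
  refine ncard_le_ncard fun j hj => ?_
  have hj' : ‖g j - x‖ ≤ e := by simpa using hj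
  refine ⟨?_, Or.inl (hj'.trans_lt hcon)⟩
  rintro rfl
  exact hcon.not_ge hj'

open scoped Classical in
theorem sum_knnWeight_mul_norm_le {k : ℕ} (hk₀ : 0 < k) {g : Fin N → G} {x : G} {e : ℝ}
    (hk : k ≤ (Finset.univ.filter fun i => ‖g i - x‖ ≤ e).card) :
    ∑ i, knnWeight k g x i * ‖g i - x‖ ≤ e := by
  have hkN : k ≤ N := hk.trans ((Finset.card_le_univ _).trans (by simp))
  calc ∑ i, knnWeight k g x i * ‖g i - x‖ ≤ ∑ i, knnWeight k g x i * e := by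
        refine Finset.sum_le_sum fun i _ => ?_
        by_cases hi : IsNearestNeighbor k g x i
        · exact mul_le_mul_of_nonneg_left (norm_sub_le_of_isNearestNeighbor hk hi)
            (knnWeight_nonneg _ _ _ _)
        · simp [knnWeight, hi]
    _ = e := by rw [← Finset.sum_mul, sum_knnWeight hk₀ hkN, one_mul]

theorem measurable_knnWeight [MeasurableSpace G] [BorelSpace G] [SecondCountableTopology G]
    (k : ℕ) (x : G) (i : Fin N) : Measurable fun g : Fin N → G => knnWeight k g x i := by
  classical
  have hn : ∀ j, Measurable fun g : Fin N → G => ‖g j - x‖ := fun j => by fun_prop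
  have hcl : ∀ j, MeasurableSet {g : Fin N → G | j ≠ i ∧ Closer g x j i} := fun j =>
    (MeasurableSet.const _).inter ((measurableSet_lt (hn j) (hn i)).union
      ((measurableSet_eq_fun (hn j) (hn i)).inter (MeasurableSet.const _)))
  have hcard : Measurable fun g : Fin N → G => {j : Fin N | j ≠ i ∧ Closer g x j i}.ncard := by
    have heq : (fun g : Fin N → G => {j : Fin N | j ≠ i ∧ Closer g x j i}.ncard) =
        fun g => ∑ j, if j ≠ i ∧ Closer g x j i then 1 else 0 := by
      funext g
      rw [ncard_eq_toFinset_card', ← Finset.card_filter]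
      congr 1
      ext j
      simp
    rw [heq]
    exact Finset.measurable_sum _ fun j _ => Measurable.ite (hcl j) measurable_const measurable_const
  exact Measurable.ite (hcard measurableSet_Iio) measurable_const measurable_const

end NearestNeighbor

/-! ### Kernel regression weights. -/

section Kernel

theorem measurable_of_kernel {K : ℝ → ℝ}
    (hK : K = gaussianKernel ∨ K = triangularKernel ∨ K = epanechnikovKernel) : Measurable K := by
  rcases hK with rfl | rfl | rfl
  · unfold gaussianKernel
    fun_prop
  · exact Measurable.ite measurableSet_Iic (by fun_prop) measurable_const
  · exact Measurable.ite measurableSet_Iic (by fun_prop) measurable_const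

/-- The three kernels are bounded, have exponentially decaying tails, and are bounded away from
zero near the origin. -/
theorem kernel_bounds {K : ℝ → ℝ}
    (hK : K = gaussianKernel ∨ K = triangularKernel ∨ K = epanechnikovKernel) :
    ∃ c C : ℝ, 0 < c ∧ 0 < C ∧
      (∀ u, 0 ≤ u → 0 ≤ K u ∧ K u ≤ C ∧ u * K u ≤ C * Real.exp (-u)) ∧
      ∀ u, 0 ≤ u → u ≤ 1 / 2 → c ≤ K u := by
  have hone : (1 : ℝ) ≤ Real.exp 2 := Real.one_le_exp zero_le_two
  -- The constant `exp 2` is dictated by the Gaussian: `u ≤ exp u` and `u - u ^ 2 / 2 ≤ 2 - u`, the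
  -- latter being `(u - 2) ^ 2 ≥ 0`. It also suffices for the compactly supported kernels.
  have hcompact : ∀ u : ℝ, u ≤ 1 → 1 ≤ Real.exp 2 * Real.exp (-u) := fun u hu => by
    rw [← Real.exp_add]
    exact Real.one_le_exp (by linarith)
  rcases hK with rfl | rfl | rfl
  · have hpi : (1 : ℝ) ≤ Real.sqrt (2 * Real.pi) := by
      rw [Real.one_le_sqrt]
      linarith [Real.pi_gt_three]
    have hc : 1 / Real.sqrt (2 * Real.pi) ≤ 1 := (div_le_one (by positivity)).2 hpi
    have hc₀ : 0 < 1 / Real.sqrt (2 * Real.pi) := by positivity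
    refine ⟨gaussianKernel (1 / 2), Real.exp 2, by unfold gaussianKernel; positivity,
      Real.exp_pos _, fun u hu => ⟨by unfold gaussianKernel; positivity, ?_, ?_⟩,
      fun u hu hu' => ?_⟩
    · unfold gaussianKernel
      have h1 : Real.exp (-u ^ 2 / 2) ≤ 1 := Real.exp_le_one_iff.2 (by nlinarith)
      nlinarith [Real.exp_pos (-u ^ 2 / 2)]
    · unfold gaussianKernel
      have h1 : u ≤ Real.exp u := by linarith [Real.add_one_le_exp u]
      calc u * (1 / Real.sqrt (2 * Real.pi) * Real.exp (-u ^ 2 / 2))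
          ≤ Real.exp u * (1 * Real.exp (-u ^ 2 / 2)) := by gcongr
        _ ≤ Real.exp 2 * Real.exp (-u) := by
          rw [one_mul, ← Real.exp_add, ← Real.exp_add, Real.exp_le_exp]
          nlinarith [sq_nonneg (u - 2)]
    · unfold gaussianKernel
      refine mul_le_mul_of_nonneg_left (Real.exp_le_exp.2 ?_) hc₀.le
      nlinarith
  · refine ⟨1 / 2, Real.exp 2, by norm_num, Real.exp_pos _, fun u hu => ?_, fun u hu hu' => ?_⟩
    · unfold triangularKernel
      split_ifs with h
      · have := hcompact u h
        exact ⟨by linarith, by linarith, by nlinarith⟩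
      · rw [mul_zero]
        exact ⟨le_rfl, by positivity, by positivity⟩
    · rw [triangularKernel, if_pos (by linarith)]
      linarith
  · refine ⟨9 / 16, Real.exp 2, by norm_num, Real.exp_pos _, fun u hu => ?_, fun u hu hu' => ?_⟩
    · unfold epanechnikovKernel
      split_ifs with h
      · have := hcompact u h
        exact ⟨by nlinarith, by nlinarith, by nlinarith [mul_nonneg hu (sq_nonneg u)]⟩
      · rw [mul_zero]
        exact ⟨le_rfl, by positivity, by positivity⟩
    · rw [epanechnikovKernel, if_pos (by linarith)]
      nlinarith

variable {G : Type*} [NormedAddCommGroup G] {N : ℕ}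

theorem measurable_kernelWeight [MeasurableSpace G] [BorelSpace G] [SecondCountableTopology G]
    {K : ℝ → ℝ} (hK : Measurable K) (h : ℝ) (x : G) (i : Fin N) :
    Measurable fun g : Fin N → G => kernelWeight K h g x i := by
  unfold kernelWeight
  fun_prop

open scoped Classical in
/-- Kernel weights are well behaved when a positive number of samples is close to `x`. -/
theorem kernelWeight_bounds {K : ℝ → ℝ} {c C : ℝ} (hC : 0 < C)
    (hK : ∀ u, 0 ≤ u → 0 ≤ K u ∧ K u ≤ C ∧ u * K u ≤ C * Real.exp (-u))
    (hKc : ∀ u, 0 ≤ u → u ≤ 1 / 2 → c ≤ K u) {h D : ℝ} (hh : 0 < h) (hD : 0 < D)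
    {g : Fin N → G} {x : G}
    (hcard : D ≤ c * ((Finset.univ.filter fun i => ‖g i - x‖ ≤ h / 2).card : ℝ)) :
    (∀ i, 0 ≤ kernelWeight K h g x i ∧ kernelWeight K h g x i ≤ C / D) ∧
      ∑ i, kernelWeight K h g x i = 1 ∧
      ∀ A, 0 ≤ A → ∑ i, kernelWeight K h g x i * ‖g i - x‖ ≤
        h * (A + N * (C * Real.exp (-A)) / D) := by
  have hu : ∀ i, 0 ≤ ‖g i - x‖ / h := fun i => by positivity
  set S : ℝ := ∑ j, K (‖g j - x‖ / h) with hS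
  have hDS : D ≤ S := by
    refine hcard.trans ?_
    calc c * ((Finset.univ.filter fun i => ‖g i - x‖ ≤ h / 2).card : ℝ)
        = ∑ i ∈ Finset.univ.filter fun i => ‖g i - x‖ ≤ h / 2, c := by
          rw [Finset.sum_const, nsmul_eq_mul, mul_comm]
      _ ≤ ∑ i ∈ Finset.univ.filter fun i => ‖g i - x‖ ≤ h / 2, K (‖g i - x‖ / h) := by
          refine Finset.sum_le_sum fun i hi => hKc _ (hu i) ?_
          rw [div_le_iff₀ hh]
          have := (Finset.mem_filter.1 hi).2
          linarith
      _ ≤ S := Finset.sum_le_sum_of_subset_of_nonneg (Finset.filter_subset _ _)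
          fun i _ _ => (hK _ (hu i)).1
  have hS₀ : 0 < S := hD.trans_le hDS
  refine ⟨fun i => ⟨div_nonneg (hK _ (hu i)).1 hS₀.le, ?_⟩, ?_, fun A hA => ?_⟩
  · exact div_le_div₀ hC.le (hK _ (hu i)).2.1 hD hDS
  · unfold kernelWeight
    rw [← Finset.sum_div, div_self hS₀.ne']
  -- The cutoff `A` handles the Gaussian's unbounded support: scaled distances below `A` cost a
  -- factor `A`, and larger ones are paid for by the exponential tail.
  · have h1 : ∀ i, ‖g i - x‖ / h * K (‖g i - x‖ / h) ≤
        A * K (‖g i - x‖ / h) + C * Real.exp (-A) := by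
      intro i
      rcases le_total (‖g i - x‖ / h) A with h2 | h2
      · have := mul_le_mul_of_nonneg_right h2 (hK _ (hu i)).1
        have : 0 ≤ C * Real.exp (-A) := by positivity
        linarith
      · have h3 : C * Real.exp (-(‖g i - x‖ / h)) ≤ C * Real.exp (-A) :=
          mul_le_mul_of_nonneg_left (Real.exp_le_exp.2 (neg_le_neg h2)) hC.le
        have := mul_nonneg hA (hK _ (hu i)).1
        linarith [(hK _ (hu i)).2.2]
    have h2 : ∑ i, kernelWeight K h g x i * ‖g i - x‖ =
        h * ((∑ i, ‖g i - x‖ / h * K (‖g i - x‖ / h)) / S) := by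
      unfold kernelWeight
      rw [← hS, Finset.sum_div, Finset.mul_sum]
      refine Finset.sum_congr rfl fun i _ => ?_
      field_simp
    rw [h2]
    refine mul_le_mul_of_nonneg_left ?_ hh.le
    have h3 := Finset.sum_le_sum fun i (_ : i ∈ Finset.univ) => h1 i
    rw [Finset.sum_add_distrib, ← Finset.mul_sum, ← hS, Finset.sum_const, Finset.card_univ,
      Fintype.card_fin, nsmul_eq_mul] at h3
    calc (∑ i, ‖g i - x‖ / h * K (‖g i - x‖ / h)) / S
        ≤ (A * S + N * (C * Real.exp (-A))) / S := div_le_div_of_nonneg_right h3 hS₀.le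
      _ = A + N * (C * Real.exp (-A)) / S := by
          rw [add_div, mul_div_cancel_right₀ _ hS₀.ne']
      _ ≤ A + N * (C * Real.exp (-A)) / D := by gcongr

end Kernel

/-! ### Verification for the two parameter choices. -/

section Rates

variable {r : ℝ≥0∞} [Fact (1 ≤ r)] {dγ dξ : ℕ} {Γ : Set (Vec r dγ)}
  {μ : Measure (Vec r dγ × Vec r dξ)} [IsProbabilityMeasure μ]
  {κ : Kernel (Vec r dγ) (Vec r dξ)} [IsMarkovKernel κ]
  {w : WeightFamily (Vec r dγ)} {ε : ℕ → ℝ}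

theorem ae_eventually_wasserstein1_le_of_knnChoice (hdγ : 1 ≤ dγ) (hΓ : ∀ᵐ z ∂μ, z.1 ∈ Γ)
    (hκ : μ.IsCondKernel κ) (hparam : KnnChoice dγ dξ w ε)
    (hsub : ConditionallySubgaussian Γ κ) (hlip : WassersteinLipschitz Γ κ)
    (hsmooth : SmoothSideInformation dγ Γ μ) {x : Vec r dγ} (hx : x ∈ Γ) :
    ∀ᵐ ω ∂(Measure.infinitePi fun _ : ℕ => μ), ∀ᶠ N : ℕ in atTop,
      wasserstein1 (κ x) (empiricalConditional w N x ω) ≤ ENNReal.ofReal (ε N) := by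
  classical
  obtain ⟨k₁, k₃, δ, p, hk₁, hk₃, hδ, hδ1, hp, hpm, hN⟩ := hparam
  obtain ⟨hΓc, g, hg, hball⟩ := hsmooth
  have hd : (0 : ℝ) < dγ := by exact_mod_cast hdγ
  have hpγ : p < (1 - δ) / dγ := hpm.trans_le (min_le_left _ _)
  have hpξ : p < (2 * δ - 1) / (dξ + 2) := hpm.trans_le (min_le_right _ _)
  rw [lt_div_iff₀ (by positivity)] at hpξ
  -- Balls of radius `N ^ (-a)` contain about `N ^ (1 - a dγ)` samples or more, eventually exceeding
  -- `k_N ~ N ^ δ`; since `a > p` the bias is small enough. The counting lemma applies because `a dγ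
  -- < 1 - δ < 1 / 2`.
  obtain ⟨a, hpa, haγ⟩ := exists_between hpγ
  rw [lt_div_iff₀ hd] at haγ
  have hcount := ae_eventually_le_card_ball (μ := μ) (x := x) hg one_pos (hp.trans hpa)
    (by linarith) (fun e he he1 => hball e he he1 x hx)
  have hk : ∀ᶠ N : ℕ in atTop, 1 ≤ N ∧
      min ⌈k₃ * (N : ℝ) ^ δ⌉₊ (N - 1) = ⌈k₃ * (N : ℝ) ^ δ⌉₊ ∧
      (⌈k₃ * (N : ℝ) ^ δ⌉₊ : ℝ) ≤ g / 2 * 1 ^ dγ * (N : ℝ) ^ (1 - a * dγ) := by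
    filter_upwards [eventually_ge_atTop 4,
      eventually_mul_rpow_le hδ1 k₃ (B := 1 / 2) (by norm_num),
      eventually_mul_rpow_le (α := δ) (β := 1 - a * dγ) (by linarith) k₃ (B := g / 4)
        (by positivity),
      eventually_mul_rpow_le (α := 0) (β := 1 - a * dγ) (by linarith) 1 (B := g / 4)
        (by positivity)] with N h0 h1 h2 h3
    have h4 := (Nat.ceil_lt_add_one (a := k₃ * (N : ℝ) ^ δ) (by positivity)).le
    rw [Real.rpow_one] at h1
    rw [Real.rpow_zero] at h3
    have h0' : (4 : ℝ) ≤ N := by exact_mod_cast h0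
    refine ⟨by omega, min_eq_left ?_, ?_⟩
    · have h5 : (⌈k₃ * (N : ℝ) ^ δ⌉₊ : ℝ) ≤ ((N - 1 : ℕ) : ℝ) := by
        rw [Nat.cast_sub (by omega)]
        push_cast
        linarith
      exact_mod_cast h5
    · rw [one_pow]
      linarith
  -- The weights are at most `1 / (k₃ N ^ δ)`, so `s = δ`, and `p (dξ + 2) < 2 δ - 1 < δ`.
  have hmain := ae_eventually_wasserstein1_le (b := a) (B := 1) (s := δ) (C := 1 / k₃) hΓ hΓc hκ
    hsub hlip hx (w := w)
    (by
      filter_upwards [eventually_ge_atTop 1] with N h1 i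
      simp only [(hN N h1).2]
      exact measurable_knnWeight _ _ _)
    hk₁ hp (by linarith) hpa (by positivity)
    (by
      filter_upwards [hcount] with ω hω
      filter_upwards [hω, hk] with N h1 h2
      obtain ⟨h2, h3, h4⟩ := h2
      have hN0 : (0 : ℝ) < N := by exact_mod_cast h2
      simp only [(hN N h2).2, h3]
      have h5 := h4.trans h1
      rw [one_mul, Nat.cast_le] at h5
      have h6 : 0 < ⌈k₃ * (N : ℝ) ^ δ⌉₊ := Nat.ceil_pos.2 (by positivity)
      refine ⟨fun i => ⟨knnWeight_nonneg _ _ _ _, (knnWeight_le _ _ _ _).trans ?_⟩,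
        sum_knnWeight h6 (h5.trans ((Finset.card_le_univ _).trans (by simp))) _ _, ?_⟩
      · rw [Real.rpow_neg hN0.le, ← one_div, one_div_mul_one_div]
        exact one_div_le_one_div_of_le (by positivity) (Nat.le_ceil _)
      · rw [one_mul]
        exact sum_knnWeight_mul_norm_le h6 h5)
  filter_upwards [hmain] with ω hω
  filter_upwards [hω, eventually_ge_atTop 1] with N h1 h2
  rwa [(hN N h2).1]

theorem ae_eventually_wasserstein1_le_of_kernelChoice (hdγ : 1 ≤ dγ) (hΓ : ∀ᵐ z ∂μ, z.1 ∈ Γ)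
    (hκ : μ.IsCondKernel κ) (hparam : KernelChoice dγ dξ w ε)
    (hsub : ConditionallySubgaussian Γ κ) (hlip : WassersteinLipschitz Γ κ)
    (hsmooth : SmoothSideInformation dγ Γ μ) {x : Vec r dγ} (hx : x ∈ Γ) :
    ∀ᵐ ω ∂(Measure.infinitePi fun _ : ℕ => μ), ∀ᶠ N : ℕ in atTop,
      wasserstein1 (κ x) (empiricalConditional w N x ω) ≤ ENNReal.ofReal (ε N) := by
  classical
  obtain ⟨K, k₁, k₄, δ, p, hK, hk₁, hk₄, hδ, hδ1, hp, hpm, hN⟩ := hparam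
  obtain ⟨hΓc, g, hg, hball⟩ := hsmooth
  have hKm := measurable_of_kernel hK
  obtain ⟨c, C, hc, hC, hKb, hKc⟩ := kernel_bounds hK
  have hd : (0 : ℝ) < dγ := by exact_mod_cast hdγ
  have hpδ : p < δ := hpm.trans_le (min_le_left _ _)
  have hpξ : p < (1 - δ * dγ) / (2 + dξ) := hpm.trans_le (min_le_right _ _)
  rw [lt_div_iff₀ (by positivity)] at hpξ
  rw [lt_div_iff₀ (by positivity)] at hδ1
  -- The kernel cutoff will be `A = N ^ a`, which costs a factor `N ^ a` in the bias and leaves the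
  -- rate `δ - a > p`.
  obtain ⟨a, ha, haδ⟩ : ∃ a, 0 < a ∧ a < δ - p := exists_between (sub_pos.2 hpδ)
  have hcount := ae_eventually_le_card_ball (μ := μ) (x := x) hg (half_pos hk₄) hδ
    (by linarith) (fun e he he1 => hball e he he1 x hx)
  set c₂ : ℝ := c * (g / 2 * (k₄ / 2) ^ dγ) with hc₂
  have hc₂₀ : 0 < c₂ := by positivity
  have hmain := ae_eventually_wasserstein1_le (b := δ - a) (B := k₄ * (1 + C / c₂))
    (s := 1 - δ * dγ) (C := C / c₂) hΓ hΓc hκ hsub hlip hx (w := w)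
    (by
      filter_upwards [eventually_ge_atTop 1] with N h1 i
      simp only [(hN N h1).2]
      exact measurable_kernelWeight hKm _ _ _)
    hk₁ hp (by linarith) (by linarith) (by positivity)
    (by
      filter_upwards [hcount] with ω hω
      filter_upwards [hω, eventually_ge_atTop 1,
        eventually_exp_neg_le one_pos ha (δ * dγ)] with N h1 h2 h3
      have hN1 : (1 : ℝ) ≤ N := by exact_mod_cast h2
      have hN0 : (0 : ℝ) < N := by linarith
      simp only [(hN N h2).2]
      have hD : c₂ * (N : ℝ) ^ (1 - δ * dγ) ≤ c * ((Finset.univ.filter fun i : Fin N =>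
          ‖(ω i).1 - x‖ ≤ k₄ * (N : ℝ) ^ (-δ) / 2).card : ℝ) := by
        have h4 := mul_le_mul_of_nonneg_left h1 hc.le
        rw [← mul_assoc, ← hc₂] at h4
        have h5 : k₄ / 2 * (N : ℝ) ^ (-δ) = k₄ * (N : ℝ) ^ (-δ) / 2 := by ring
        rwa [h5] at h4
      obtain ⟨h4, h5, h6⟩ := kernelWeight_bounds hC hKb hKc
        (h := k₄ * (N : ℝ) ^ (-δ)) (by positivity) (by positivity) hD
      refine ⟨fun i => ⟨(h4 i).1, (h4 i).2.trans (le_of_eq ?_)⟩, h5,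
        (h6 ((N : ℝ) ^ a) (by positivity)).trans ?_⟩
      · rw [Real.rpow_neg hN0.le]
        field_simp
      -- The tail beyond the cutoff stays bounded because eventually `exp (-N ^ a) ≤ N ^ (-δ dγ)`.
      · have h7 : (N : ℝ) * (C * Real.exp (-(N : ℝ) ^ a)) / (c₂ * (N : ℝ) ^ (1 - δ * dγ)) ≤
            C / c₂ := by
          rw [neg_one_mul] at h3
          calc (N : ℝ) * (C * Real.exp (-(N : ℝ) ^ a)) / (c₂ * (N : ℝ) ^ (1 - δ * dγ))
              ≤ (N : ℝ) * (C * (N : ℝ) ^ (-(δ * dγ))) / (c₂ * (N : ℝ) ^ (1 - δ * dγ)) := by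
                gcongr
            _ = C / c₂ := by
                rw [sub_eq_add_neg, Real.rpow_add hN0, Real.rpow_one]
                field_simp
        have h8 : 1 ≤ (N : ℝ) ^ a := Real.one_le_rpow hN1 ha.le
        have h9 : 0 ≤ C / c₂ := by positivity
        calc k₄ * (N : ℝ) ^ (-δ) * ((N : ℝ) ^ a +
              N * (C * Real.exp (-(N : ℝ) ^ a)) / (c₂ * (N : ℝ) ^ (1 - δ * dγ)))
            ≤ k₄ * (N : ℝ) ^ (-δ) * ((N : ℝ) ^ a * (1 + C / c₂)) :=
              mul_le_mul_of_nonneg_left (by nlinarith) (by positivity)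
          _ = k₄ * (1 + C / c₂) * (N : ℝ) ^ (-(δ - a)) := by
              rw [neg_sub, sub_eq_add_neg, Real.rpow_add hN0]
              ring)
  filter_upwards [hmain] with ω hω
  filter_upwards [hω, eventually_ge_atTop 1] with N h1 h2
  rwa [(hN N h2).1]

end Rates

end SideInfo

theorem theorem2 {r : ℝ≥0∞} [Fact (1 ≤ r)] (dγ dξ : ℕ) (hdγ : 1 ≤ dγ)
    (Γ : Set (SideInfo.Vec r dγ))
    (μ : Measure (SideInfo.Vec r dγ × SideInfo.Vec r dξ)) [IsProbabilityMeasure μ]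
    (hΓ : ∀ᵐ z ∂μ, z.1 ∈ Γ)
    (κ : Kernel (SideInfo.Vec r dγ) (SideInfo.Vec r dξ)) [IsMarkovKernel κ]
    (hκ : μ.IsCondKernel κ)
    (w : SideInfo.WeightFamily (SideInfo.Vec r dγ)) (ε : ℕ → ℝ)
    (hparam : SideInfo.KnnChoice dγ dξ w ε ∨ SideInfo.KernelChoice dγ dξ w ε)
    (hsub : SideInfo.ConditionallySubgaussian Γ κ)
    (hlip : SideInfo.WassersteinLipschitz Γ κ)
    (hsmooth : SideInfo.SmoothSideInformation dγ Γ μ) :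
    ∀ x ∈ Γ,
      Measure.infinitePi (fun _ : ℕ => μ)
        {ω | ∃ᶠ N : ℕ in atTop, ENNReal.ofReal (ε N) <
          SideInfo.wasserstein1 (κ x) (SideInfo.empiricalConditional w N x ω)} = 0 := by
  intro x hx
  have h : ∀ᵐ ω ∂(Measure.infinitePi fun _ : ℕ => μ), ∀ᶠ N : ℕ in atTop,
      SideInfo.wasserstein1 (κ x) (SideInfo.empiricalConditional w N x ω) ≤
        ENNReal.ofReal (ε N) := by
    rcases hparam with hparam | hparam
    · exact SideInfo.ae_eventually_wasserstein1_le_of_knnChoice hdγ hΓ hκ hparam hsub hlip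
        hsmooth hx
    · exact SideInfo.ae_eventually_wasserstein1_le_of_kernelChoice hdγ hΓ hκ hparam hsub hlip
        hsmooth hx
  refine measure_mono_null (fun ω hω => ?_) h
  intro hcon
  exact hω (hcon.mono fun N hN => not_lt.2 hN)
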